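/- Let $\tau>0$ be real, let $\wp$ be the Weierstrass $\wp$-function of the lattice $\Lambda=\mathbb{Z}+\mathbb{Z}i\tau$, let $d\ge 0$ be an integer, and let $P\in\mathbb{C}[X,Y]$ be a nonzero polynomial of degree at most $d$ in $X$ and at most $d$ in $Y$. Then for every $\omega\in\Lambda$ the meromorphic function $z\mapsto P(z,\wp(z))$ has at most $8d^2+14d+5$ zeros, counted with multiplicity, in the closed fundamental rectangle $\{\omega+s+ti\tau : 0\le s,t\le 1\}$. -/

import Mathlib

open Complex

/-- The period pair `(1, iτ)` with `τ > 0`; its lattice is `ℤ + ℤ iτ`. -/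
noncomputable def rectPeriodPair (τ : ℝ) (hτ : 0 < τ) : PeriodPair where
  ω₁ := 1
  ω₂ := I * τ
  indep := by
    rw [LinearIndependent.pair_iff]
    intro s t h
    have hre := congrArg Complex.re h
    have him := congrArg Complex.im h
    simp at hre him
    exact ⟨hre, him.resolve_right hτ.ne'⟩

/-- The closed fundamental rectangle with sides `1` and `iτ` whose lower left vertex is `ω`. -/
def fundamentalRectangle (τ : ℝ) (ω : ℂ) : Set ℂ :=
  {z | ∃ s ∈ Set.Icc (0 : ℝ) 1, ∃ t ∈ Set.Icc (0 : ℝ) 1, z = ω + s + t * (I * τ)}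

/-- The multiplicity of `z` as a zero of the meromorphic function `f`: the order of `f` at `z` if
this is positive, `0` if `z` is a pole or a point where `f` has a nonzero finite limit, and `∞` if
`f` vanishes identically near `z`. -/
noncomputable def zeroMultiplicity (f : ℂ → ℂ) (z : ℂ) : ℕ∞ :=
  WithTop.map Int.toNat (meromorphicOrderAt f z)

/-! ### Resultant with the conjugate polynomial and the count of real roots -/

section Resultant

open Polynomial

/-! Translating by ω replaces P(X, Y) by p = P(X + ω, Y) and reduces to the rectangle at 0. This is
enlarged by half a period on every side, to R = [-1/2, 3/2] × [-τ/2, 3τ/2]. The boundary of R avoids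
Λ; ℘ is real there because conj z ≡ ±z mod Λ; and ℘ has one value y₀ at the four corners, which are
congruent mod Λ (`isRealOnBoundary_weierstrassP`).

Let p have degree at most m in X and degree n in Y. Compare p(z, ℘(z)) with p(z, y₀), a polynomial
in z with at most m zeros. By the argument principle (`rectIntegral_logDeriv`) their order sums in R
differ by the number of turns of the quotient along ∂R. On one edge, with real parameter t, the
quotient is ∏ (y(t) - z_j(t)) / (y₀ - z_j(t)), where y(t) is real and the z_j(t) are the roots of
the restricted polynomial Q(t, ·). A factor with z_j non-real avoids the negative real axis
(`div_sub_mem_slitPlane`), and the quotient is 1 at both ends of the edge, so the number of turns is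
at most the number of real roots met along the edge (`abs_arg_variation_le`). A real root of Q(t, ·)
is shared with the conjugate polynomial; hence the resultant of Q and its conjugate vanishes at t to
at least the order given by the number of real roots (`realRootCount_le_rootMultiplicity`). That
resultant has degree at most 2mn. Four edges give the bound 8mn + m for the order sum in R. The four
lattice points in R are poles of order at most 2n, so there are at most 8mn + m + 8n zeros.

The argument needs general position: nonzero resultants, and no zeros on ∂R. A small shift p(X - κ,
Y - e) achieves this (`exists_isGenericOn_shiftPoly`). The count returns to p by a Rouché argument
on a slightly smaller rectangle (`sum_toNat_meromorphicOrderAt_evalAlong_le`). -/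

/-- The determinant of a polynomial matrix is divisible by `(X - t) ^ s` when the matrix drops
rank by at least `s` at `t`. -/
theorem Matrix.X_sub_C_pow_dvd_det {K n : Type*} [Field K] [Fintype n] [DecidableEq n]
    (M : Matrix n n K[X]) (t : K) (s : ℕ)
    (h : s ≤ Module.finrank K (LinearMap.ker (M.map (eval t)).mulVecLin)) :
    (X - C t) ^ s ∣ M.det := by
  classical
  set W := LinearMap.ker (M.map (eval t)).mulVecLin with hW
  set r := Module.finrank K W
  have hr : LinearIndependent K (fun i : Fin r => ((Module.finBasis K W i : W) : n → K)) :=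
    (Module.finBasis K W).linearIndependent.map' W.subtype (Submodule.ker_subtype W)
  let B := Module.Basis.sumExtend hr
  let e := B.indexEquiv (Pi.basisFun K n)
  let A : Matrix n n K := (Pi.basisFun K n).toMatrix (B.reindex e)
  have hA : IsUnit A.det := by
    have := (Pi.basisFun K n).isUnit_det (B.reindex e)
    rwa [Module.Basis.det_apply] at this
  have hker : ∀ i : Fin r, (M.map (eval t)).mulVec (B (Sum.inl i)) = 0 := by
    intro i
    have h1 : B (Sum.inl i) = ((Module.finBasis K W i : W) : n → K) := by
      simp only [B, Module.Basis.sumExtend, Module.Basis.reindex_apply]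
      simp only [Module.Basis.extend_apply_self]
      rfl
    rw [h1]
    exact (Module.finBasis K W i).2
  -- The columns of `M * A` that come from the kernel vanish at `t`; `v` records the factor `X - t`
  -- taken out of each of them.
  let v : n → K[X] := fun j => Sum.elim (fun _ => X - C t) (fun _ => 1) (e.symm j)
  have hdvd : ∀ i j, v j ∣ (M * A.map C) i j := by
    intro i j
    rcases hj : e.symm j with k | k
    · simp only [v, hj, Sum.elim_inl]
      rw [dvd_iff_isRoot, IsRoot.def]
      have h2 := congrFun (hker k) i
      have h3 : e (Sum.inl k) = j := by rw [← hj, Equiv.apply_symm_apply]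
      rw [Pi.zero_apply] at h2
      rw [← h2, Matrix.mul_apply, eval_finsetSum, Matrix.mulVec, dotProduct]
      refine Finset.sum_congr rfl fun l _ => ?_
      simp [A, Module.Basis.toMatrix_apply, hj]
    · simp [v, hj]
  choose N hN using hdvd
  have hfac : M * A.map C = Matrix.of (fun i j => v j * Matrix.of N i j) := by
    ext1 i j; simp [hN]
  have hdet : M.det * C A.det = (∏ j, v j) * (Matrix.of N).det := by
    rw [← Matrix.det_mul_row, ← hfac, Matrix.det_mul]
    congr 1
    exact RingHom.map_det (C : K →+* K[X]) A
  have hprod : ∏ j, v j = (X - C t) ^ r := by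
    have : Fintype (Module.Basis.sumExtendIndex hr) := Fintype.ofInjective
      (fun k => e (Sum.inr k)) (e.injective.comp Sum.inr_injective)
    rw [← Equiv.prod_comp e]
    simp only [v, Equiv.symm_apply_apply]
    rw [Fintype.prod_sum_type]
    simp
  have h5 : (X - C t) ^ s ∣ M.det * C A.det := by
    rw [hdet, hprod]
    exact (pow_dvd_pow _ h).mul_right _
  exact (IsUnit.dvd_mul_right (hA.map C)).1 h5

/-- With f = D f' and g = D g', every pair (-f' w, g' w) with deg w < deg D satisfies g · (-f' w) +
f · (g' w) = 0. These pairs embed a space of dimension deg D in the kernel. -/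
theorem Polynomial.le_finrank_ker_sylvester {K : Type*} [Field K] {f g D : K[X]} {m n : ℕ}
    (hf0 : f ≠ 0) (hg0 : g ≠ 0) (hf : f.natDegree ≤ m) (hg : g.natDegree ≤ n)
    (hDf : D ∣ f) (hDg : D ∣ g) :
    D.natDegree ≤ Module.finrank K (LinearMap.ker (sylvester f g m n).mulVecLin) := by
  classical
  obtain ⟨f', rfl⟩ := hDf
  obtain ⟨g', rfl⟩ := hDg
  have hD : D ≠ 0 := left_ne_zero_of_mul hf0
  have hf' : f' ≠ 0 := right_ne_zero_of_mul hf0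
  have hg' : g' ≠ 0 := right_ne_zero_of_mul hg0
  rw [natDegree_mul hD hf'] at hf
  rw [natDegree_mul hD hg'] at hg
  have hmem : ∀ (q : K[X]) (k : ℕ), D.natDegree + q.natDegree ≤ k → q ≠ 0 →
      ∀ w ∈ degreeLT K D.natDegree, q * w ∈ degreeLT K k := by
    intro q k hk hq w hw
    rw [mem_degreeLT] at hw ⊢
    rcases eq_or_ne w 0 with rfl | hw0
    · simp
    · rw [degree_eq_natDegree hw0] at hw
      rw [degree_mul, degree_eq_natDegree hw0, degree_eq_natDegree hq]
      norm_cast at hw ⊢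
      omega
  let φ : degreeLT K D.natDegree →ₗ[K] (degreeLT K m × degreeLT K n) :=
    LinearMap.prod
      (((LinearMap.mulLeft K (-f')).domRestrict (degreeLT K D.natDegree)).codRestrict
        (degreeLT K m) (fun w => hmem (-f') m (by simpa using hf) (neg_ne_zero.2 hf') w.1 w.2))
      (((LinearMap.mulLeft K g').domRestrict (degreeLT K D.natDegree)).codRestrict
        (degreeLT K n) (fun w => hmem g' n hg hg' w.1 w.2))
  have hφ₁ : ∀ w, ((φ w).1 : K[X]) = -f' * w := fun _ => rfl
  have hφ₂ : ∀ w, ((φ w).2 : K[X]) = g' * w := fun _ => rfl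
  have hφ : Function.Injective φ := by
    rw [injective_iff_map_eq_zero]
    intro w hw
    have := congrArg (fun z => ((z.2 : degreeLT K n) : K[X])) hw
    simp only [hφ₂] at this
    exact Subtype.ext ((mul_eq_zero.1 this).resolve_left hg')
  have hfm : (D * f').natDegree ≤ m := by rwa [natDegree_mul hD hf']
  have hgn : (D * g').natDegree ≤ n := by rwa [natDegree_mul hD hg']
  let S := sylvesterMap (D * f') (D * g') hfm hgn
  have hker : ∀ w, φ w ∈ LinearMap.ker S := by
    intro w
    rw [LinearMap.mem_ker]
    ext1
    simp only [S, sylvesterMap_apply_coe, hφ₁, hφ₂, Submodule.coe_zero]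
    ring
  let b₁ := ((degreeLT.basis K m).prod (degreeLT.basis K n)).reindex finSumFinEquiv
  let b₂ := degreeLT.basis K (m + n)
  have hmat : LinearMap.toMatrix b₁ b₂ S = sylvester (D * f') (D * g') m n :=
    toMatrix_sylvesterMap' _ _ hfm hgn
  let ψ : degreeLT K D.natDegree →ₗ[K]
      LinearMap.ker (sylvester (D * f') (D * g') m n).mulVecLin :=
    ((b₁.equivFun : _ →ₗ[K] _) ∘ₗ φ).codRestrict _ (by
      intro w
      rw [LinearMap.mem_ker, Matrix.mulVecLin_apply, ← hmat]
      have := LinearMap.toMatrix_mulVec_repr b₁ b₂ S (φ w)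
      rw [LinearMap.mem_ker.1 (hker w)] at this
      simpa using this)
  have hψ : Function.Injective ψ := by
    intro x y hxy
    apply hφ
    apply b₁.equivFun.injective
    exact congrArg Subtype.val hxy
  have := LinearMap.finrank_le_finrank_of_injective hψ
  rwa [(degreeLTEquiv K D.natDegree).finrank_eq, Module.finrank_fin_fun] at this

theorem Matrix.natDegree_det_le {R n : Type*} [CommRing R] [Fintype n] [DecidableEq n]
    (M : Matrix n n R[X]) (a : ℕ) (h : ∀ i j, (M i j).natDegree ≤ a) :
    M.det.natDegree ≤ Fintype.card n * a := by
  rw [Matrix.det_apply]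
  refine natDegree_sum_le_of_forall_le _ _ fun σ _ => ?_
  refine (natDegree_smul_le _ _).trans ?_
  refine (natDegree_prod_le _ _).trans ?_
  calc ∑ i, (M (σ i) i).natDegree ≤ ∑ _i : n, a := Finset.sum_le_sum fun i _ => h _ _
    _ = _ := by simp

/-- The polynomial obtained from a bivariate polynomial by conjugating all coefficients. -/
noncomputable def conjBivariate (Q : ℂ[X][X]) : ℂ[X][X] := Q.map (mapRingHom (starRingEnd ℂ))

/-- The univariate polynomial `Q(t, ·)`, where `t` replaces the inner variable. -/
noncomputable def specialize (Q : ℂ[X][X]) (t : ℂ) : ℂ[X] := Q.map (evalRingHom t)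

/-- The number of real roots of `Q(t, ·)`, counted with multiplicity. -/
noncomputable def realRootCount (Q : ℂ[X][X]) (t : ℂ) : ℕ :=
  Multiset.card ((specialize Q t).roots.filter (fun z => z.im = 0))

/-- The resultant of a bivariate polynomial and its conjugate, in the outer variable. -/
noncomputable def conjResultant (Q : ℂ[X][X]) : ℂ[X] :=
  resultant Q (conjBivariate Q) Q.natDegree Q.natDegree

/-- Realness of `t` is essential: conjugating coefficients commutes with substituting `t` because
conj t = t. -/
theorem specialize_conjBivariate (Q : ℂ[X][X]) (t : ℝ) :
    specialize (conjBivariate Q) t = (specialize Q t).map (starRingEnd ℂ) := by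
  rw [specialize, conjBivariate, specialize, map_map, map_map]
  congr 1
  ext x
  · simp
  · simp

/-- The Sylvester matrix has size 2 · `Q.natDegree`, and its entries are coefficients of `Q`, their
conjugates, or zero. -/
theorem natDegree_conjResultant_le (Q : ℂ[X][X]) (a : ℕ)
    (ha : ∀ k, (Q.coeff k).natDegree ≤ a) :
    (conjResultant Q).natDegree ≤ 2 * a * Q.natDegree := by
  rw [conjResultant, resultant]
  refine (Matrix.natDegree_det_le _ a fun i j => ?_).trans (le_of_eq ?_)
  · induction j using Fin.addCases with
    | left j =>
      simp only [sylvester, Matrix.of_apply, Fin.addCases_left]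
      split_ifs
      · rw [conjBivariate, coeff_map, coe_mapRingHom]
        exact natDegree_map_le.trans (ha _)
      · simp
    | right j =>
      simp only [sylvester, Matrix.of_apply, Fin.addCases_right]
      split_ifs
      · exact ha _
      · simp
  · simp; ring

theorem natDegree_specialize (Q : ℂ[X][X]) (t : ℂ) (h : Q.leadingCoeff.eval t ≠ 0) :
    (specialize Q t).natDegree = Q.natDegree :=
  natDegree_map_of_leadingCoeff_ne_zero _ h

theorem specialize_ne_zero (Q : ℂ[X][X]) (t : ℂ) (h : Q.leadingCoeff.eval t ≠ 0) :
    specialize Q t ≠ 0 := by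
  intro h0
  have := congrArg (fun p => p.coeff Q.natDegree) h0
  simp [specialize] at this
  exact h this

theorem eval_conjResultant (Q : ℂ[X][X]) (t : ℝ) (h : Q.leadingCoeff.eval (t : ℂ) ≠ 0) :
    (conjResultant Q).eval (t : ℂ) =
      resultant (specialize Q t) ((specialize Q t).map (starRingEnd ℂ)) := by
  rw [← specialize_conjBivariate]
  have h1 : (specialize (conjBivariate Q) t).natDegree = Q.natDegree := by
    rw [specialize_conjBivariate, natDegree_map_eq_of_injective (starRingEnd ℂ).injective,
      natDegree_specialize Q t h]
  rw [h1, natDegree_specialize Q t h, conjResultant, ← coe_evalRingHom, ← resultant_map_map]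
  rfl

/-- The product D of X - z over the real roots z of Q(t, ·) is its own conjugate, so it divides both
polynomials. The Sylvester matrix therefore drops rank by deg D at `t`, and its determinant vanishes
there to that order. -/
theorem realRootCount_le_rootMultiplicity (Q : ℂ[X][X]) (t : ℝ)
    (h : Q.leadingCoeff.eval (t : ℂ) ≠ 0) (hres : conjResultant Q ≠ 0) :
    realRootCount Q t ≤ (conjResultant Q).rootMultiplicity (t : ℂ) := by
  rw [le_rootMultiplicity_iff hres, conjResultant, resultant]
  apply Matrix.X_sub_C_pow_dvd_det
  have hmap : (sylvester Q (conjBivariate Q) Q.natDegree Q.natDegree).map (eval (t : ℂ)) =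
      sylvester (specialize Q t) (specialize (conjBivariate Q) t) Q.natDegree Q.natDegree := by
    rw [specialize, specialize, sylvester_map_map]
    rfl
  rw [hmap]
  set p := specialize Q t with hp
  have hp0 : p ≠ 0 := specialize_ne_zero Q t h
  have hpd : p.natDegree = Q.natDegree := natDegree_specialize Q t h
  set m := p.roots.filter (fun z => z.im = 0) with hm
  have hD : (m.map (fun z => X - C z)).prod.natDegree = realRootCount Q t := by
    rw [natDegree_multiset_prod_X_sub_C_eq_card]
    rfl
  have hDp : (m.map (fun z => X - C z)).prod ∣ p :=
    (Multiset.prod_dvd_prod_of_le (Multiset.map_le_map (Multiset.filter_le _ _))).trans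
      (prod_multiset_X_sub_C_dvd p)
  have hconj : (m.map (fun z => X - C z)).prod.map (starRingEnd ℂ) =
      (m.map (fun z => X - C z)).prod := by
    rw [Polynomial.map_multiset_prod, Multiset.map_map]
    congr 1
    refine Multiset.map_congr rfl fun z hz => ?_
    have : z.im = 0 := (Multiset.mem_filter.1 hz).2
    simp [Complex.conj_eq_iff_im.2 this]
  rw [← hD, specialize_conjBivariate, ← hp]
  refine le_finrank_ker_sylvester hp0 ?_ hpd.le ?_ hDp ?_
  · exact (Polynomial.map_ne_zero_iff (starRingEnd ℂ).injective).2 hp0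
  · exact natDegree_map_le.trans hpd.le
  · rw [← hconj]
    exact Polynomial.map_dvd _ hDp

theorem sum_realRootCount_le (Q : ℂ[X][X]) (a : ℕ) (ha : ∀ k, (Q.coeff k).natDegree ≤ a)
    (hres : conjResultant Q ≠ 0) (T : Finset ℝ)
    (h : ∀ t ∈ T, Q.leadingCoeff.eval (t : ℂ) ≠ 0) :
    ∑ t ∈ T, realRootCount Q t ≤ 2 * a * Q.natDegree := by
  classical
  calc ∑ t ∈ T, realRootCount Q t
      ≤ ∑ t ∈ T, (conjResultant Q).rootMultiplicity (t : ℂ) :=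
        Finset.sum_le_sum fun t ht => realRootCount_le_rootMultiplicity Q t (h t ht) hres
    _ = ∑ z ∈ T.map ⟨_, Complex.ofReal_injective⟩, (conjResultant Q).roots.count z := by
        simp [count_roots]
    _ ≤ Multiset.card (conjResultant Q).roots := by
        rw [← Multiset.toFinset_sum_count_eq]
        exact Finset.sum_le_sum_of_ne_zero fun z _ hz => by
          rwa [Multiset.mem_toFinset, ← Multiset.count_ne_zero]
    _ ≤ (conjResultant Q).natDegree := card_roots' _
    _ ≤ _ := natDegree_conjResultant_le Q a ha

theorem finite_realRootCount_ne_zero (Q : ℂ[X][X]) (hres : conjResultant Q ≠ 0) :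
    {t : ℝ | Q.leadingCoeff.eval (t : ℂ) ≠ 0 ∧ realRootCount Q t ≠ 0}.Finite := by
  refine ((conjResultant Q).roots.toFinset.finite_toSet.preimage
    Complex.ofReal_injective.injOn).subset fun t ht => ?_
  have := realRootCount_le_rootMultiplicity Q t ht.1 hres
  simp only [Set.mem_preimage, Finset.mem_coe, Multiset.mem_toFinset]
  rw [← Multiset.count_ne_zero, count_roots]
  have := ht.2
  omega

end Resultant

/-! ### Roots of Q(t, ·) as t moves, and a principle for integer-valued jumps -/

section Edge

open Polynomial Filter Topology

/-- Indexing the roots by a fixed finite type makes them points of ℂⁿ, where subsequences can be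
extracted as t varies. -/
theorem exists_tuple_roots (Q : ℂ[X][X]) (t : ℂ) (h : Q.leadingCoeff.eval t ≠ 0) :
    ∃ Y : Fin Q.natDegree → ℂ, (specialize Q t).roots = Finset.univ.val.map Y := by
  have hcard : Multiset.card (specialize Q t).roots = Q.natDegree := by
    rw [← natDegree_specialize Q t h]
    exact (splits_iff_card_roots.1 (IsAlgClosed.splits _))
  obtain ⟨l, hl⟩ := Quot.exists_rep (specialize Q t).roots
  have hl' : (specialize Q t).roots = (l : Multiset ℂ) := hl.symm
  have hlen : l.length = Q.natDegree := by rw [← hcard, hl', Multiset.coe_card]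
  refine ⟨fun j => l.get (j.cast hlen.symm), ?_⟩
  rw [hl', Fin.univ_def]
  simp only [Multiset.map_coe, Multiset.coe_eq_coe]
  refine List.Perm.of_eq (List.ext_getElem (by simp [hlen]) ?_)
  intro i h1 h2
  simp

theorem leadingCoeff_specialize (Q : ℂ[X][X]) (t : ℂ) (h : Q.leadingCoeff.eval t ≠ 0) :
    (specialize Q t).leadingCoeff = Q.leadingCoeff.eval t := by
  rw [leadingCoeff, natDegree_specialize Q t h, specialize, coeff_map]
  rfl

theorem eval_specialize_eq_prod (Q : ℂ[X][X]) (t : ℂ) (h : Q.leadingCoeff.eval t ≠ 0)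
    (Y : Fin Q.natDegree → ℂ) (hY : (specialize Q t).roots = Finset.univ.val.map Y) (z : ℂ) :
    (specialize Q t).eval z = Q.leadingCoeff.eval t * ∏ j, (z - Y j) := by
  have h1 := (IsAlgClosed.splits (specialize Q t)).eq_prod_roots
  rw [leadingCoeff_specialize Q t h, hY, Multiset.map_map] at h1
  have h2 : (Multiset.map ((fun a => X - C a) ∘ Y) Finset.univ.val).prod = ∏ j, (X - C (Y j)) := rfl
  rw [h2] at h1
  rw [h1, eval_mul, eval_C, eval_prod]
  simp

theorem roots_specialize_of_eval_eq (Q : ℂ[X][X]) (t : ℂ) (h : Q.leadingCoeff.eval t ≠ 0)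
    (Y : Fin Q.natDegree → ℂ)
    (hY : ∀ z, (specialize Q t).eval z = Q.leadingCoeff.eval t * ∏ j, (z - Y j)) :
    (specialize Q t).roots = Finset.univ.val.map Y := by
  have h1 : specialize Q t = C (Q.leadingCoeff.eval t) * ∏ j, (X - C (Y j)) := by
    refine Polynomial.funext fun z => ?_
    rw [hY, eval_mul, eval_C, eval_prod]
    simp
  rw [h1, roots_C_mul _ h]
  exact roots_multiset_prod_X_sub_C (Finset.univ.val.map Y) ▸ by
    rw [Multiset.map_map]; rfl

theorem realRootCount_eq_card (Q : ℂ[X][X]) (t : ℂ) (Y : Fin Q.natDegree → ℂ)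
    (hY : (specialize Q t).roots = Finset.univ.val.map Y) :
    realRootCount Q t = (Finset.univ.filter fun j => (Y j).im = 0).card := by
  rw [realRootCount, hY, Multiset.filter_map, Multiset.card_map]
  rfl

theorem continuous_eval_specialize (Q : ℂ[X][X]) (z : ℂ) :
    Continuous fun t : ℂ => (specialize Q t).eval z := by
  have : (fun t : ℂ => (specialize Q t).eval z) =
      fun t => ∑ k ∈ Finset.range (Q.natDegree + 1), (Q.coeff k).eval t * z ^ k := by
    ext t
    rw [specialize, eval_map, eval₂_eq_sum_range]
    rfl
  rw [this]
  fun_prop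

theorem exists_bound_roots_specialize (Q : ℂ[X][X]) {K : Set ℂ} (hK : IsCompact K)
    (h : ∀ t ∈ K, Q.leadingCoeff.eval t ≠ 0) :
    ∃ R : ℝ, ∀ t ∈ K, ∀ z ∈ (specialize Q t).roots, ‖z‖ ≤ R := by
  -- The sum of the lower coefficients dominates the supremum in the Cauchy bound and is plainly
  -- continuous in `t`.
  have hc : ContinuousOn (fun t : ℂ => (∑ k ∈ Finset.range Q.natDegree, ‖(Q.coeff k).eval t‖₊) /
      ‖Q.leadingCoeff.eval t‖₊ + 1) K := by
    refine ContinuousOn.add (ContinuousOn.div ?_ ?_ ?_) continuousOn_const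
    · fun_prop
    · fun_prop
    · intro t ht
      simpa using h t ht
  obtain ⟨R, hR⟩ := (hK.image_of_continuousOn hc).bddAbove
  refine ⟨R, fun t ht z hz => ?_⟩
  have hlc := h t ht
  have h1 := (isRoot_of_mem_roots hz).norm_lt_cauchyBound (specialize_ne_zero Q t hlc)
  have h2 : (specialize Q t).cauchyBound ≤ R := by
    refine le_trans ?_ (hR ⟨t, ht, rfl⟩)
    rw [cauchyBound, leadingCoeff_specialize Q t hlc, natDegree_specialize Q t hlc]
    beta_reduce
    gcongr
    refine Finset.sup_le fun k hk => ?_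
    have : (specialize Q t).coeff k = (Q.coeff k).eval t := by
      rw [specialize, coeff_map]; rfl
    rw [this]
    exact Finset.single_le_sum (f := fun k => ‖(Q.coeff k).eval t‖₊) (fun _ _ => zero_le) hk
  have h3 : ‖z‖₊ < (specialize Q t).cauchyBound := h1
  exact_mod_cast (h3.le.trans h2)

/-- For real y and y₀, the numbers y - z and y₀ - z lie in the same open half-plane, upper or lower,
so their quotient cannot be a nonpositive real. -/
theorem div_sub_mem_slitPlane {y y₀ : ℝ} {z : ℂ} (hz : z.im ≠ 0) :
    ((y : ℂ) - z) / ((y₀ : ℂ) - z) ∈ slitPlane := by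
  by_contra hcon
  rw [mem_slitPlane_iff, not_or, not_lt, not_not] at hcon
  obtain ⟨hre, him⟩ := hcon
  set w := ((y : ℂ) - z) / ((y₀ : ℂ) - z) with hw
  have hne : (y₀ : ℂ) - z ≠ 0 := by
    intro h0
    apply hz
    have := congrArg Complex.im h0
    simpa using this
  have h1 : (y : ℂ) - z = w * ((y₀ : ℂ) - z) := by rw [hw, div_mul_cancel₀ _ hne]
  have h2 := congrArg Complex.im h1
  simp [Complex.mul_im, him] at h2
  have h3 : (1 - w.re) * z.im = 0 := by linarith
  rcases mul_eq_zero.1 h3 with h | h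
  · linarith
  · exact hz h

/-- A function with integer values on an interval whose oscillation near each point `t` is at most
`s t`, where `s` vanishes outside a finite set, varies by at most the sum of `s`. -/
theorem abs_sub_le_sum_of_local {t₀ t₁ : ℝ} (h01 : t₀ ≤ t₁) (k : ℝ → ℝ) (s : ℝ → ℕ)
    (T : Finset ℝ) (hT : ∀ t ∈ Set.Icc t₀ t₁, s t ≠ 0 → t ∈ T)
    (hk : ∀ t ∈ Set.Icc t₀ t₁, ∃ δ > 0, ∀ u ∈ Set.Icc t₀ t₁, ∀ u' ∈ Set.Icc t₀ t₁,
      |u - t| < δ → |u' - t| < δ → |k u - k u'| ≤ s t) :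
    |k t₁ - k t₀| ≤ ∑ t ∈ T, (s t : ℝ) := by
  classical
  -- `M` jumps by `s t` at `t`, which pays for the oscillation of `k` near `t`. The bound |k u - k
  -- t₀| ≤ M u then spreads over the whole interval by a supremum argument.
  set M : ℝ → ℝ := fun u => ∑ t ∈ T.filter (· ≤ u), (s t : ℝ) with hM
  have hmono : Monotone M := by
    intro u u' huu
    refine Finset.sum_le_sum_of_subset_of_nonneg ?_ fun _ _ _ => Nat.cast_nonneg _
    exact Finset.monotone_filter_right _ fun t _ (ht : t ≤ u) => ht.trans huu
  have hself : ∀ t ∈ Set.Icc t₀ t₁, ∀ u < t, M u + s t ≤ M t := by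
    intro t ht u hut
    by_cases h0 : s t = 0
    · rw [h0, Nat.cast_zero, add_zero]; exact hmono hut.le
    · have htT := hT t ht h0
      rw [hM]
      have h1 : t ∉ T.filter (· ≤ u) := by simp [hut]
      simp only
      rw [add_comm, ← Finset.sum_insert (f := fun t => (s t : ℝ)) h1]
      refine Finset.sum_le_sum_of_subset_of_nonneg ?_ fun _ _ _ => Nat.cast_nonneg _
      intro x hx
      rw [Finset.mem_insert, Finset.mem_filter] at hx
      rw [Finset.mem_filter]
      rcases hx with rfl | ⟨hx, hxu⟩
      · exact ⟨htT, le_rfl⟩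
      · exact ⟨hx, hxu.trans hut.le⟩
  have hself' : ∀ t ∈ Set.Icc t₀ t₁, (s t : ℝ) ≤ M t := by
    intro t ht
    have h1 := hself t ht (t - 1) (by linarith)
    have h2 : 0 ≤ M (t - 1) := Finset.sum_nonneg fun _ _ => Nat.cast_nonneg _
    linarith
  set S : Set ℝ := {t | t ∈ Set.Icc t₀ t₁ ∧ ∀ u ∈ Set.Icc t₀ t, |k u - k t₀| ≤ M u} with hS
  have h0S : t₀ ∈ S := by
    refine ⟨⟨le_rfl, h01⟩, fun u hu => ?_⟩
    obtain rfl : u = t₀ := le_antisymm hu.2 hu.1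
    rw [sub_self, abs_zero]
    exact Finset.sum_nonneg fun _ _ => Nat.cast_nonneg _
  have hbdd : BddAbove S := ⟨t₁, fun t ht => ht.1.2⟩
  set c := sSup S with hc
  have hcI : c ∈ Set.Icc t₀ t₁ :=
    ⟨le_csSup hbdd h0S, csSup_le ⟨t₀, h0S⟩ fun t ht => ht.1.2⟩
  obtain ⟨δ, hδ, hloc⟩ := hk c hcI
  have hext : ∀ u ∈ Set.Icc t₀ t₁, u < c + δ → |k u - k t₀| ≤ M u := by
    intro u hu huc
    rcases lt_or_ge u c with h | h
    · obtain ⟨t, htS, hut⟩ := exists_lt_of_lt_csSup ⟨t₀, h0S⟩ h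
      exact htS.2 u ⟨hu.1, hut.le⟩
    · have hcu : |u - c| < δ := by rw [abs_lt]; constructor <;> linarith
      -- At the left end no earlier point exists to compare with, but the jump at t₀ is already
      -- included in `M t₀`.
      rcases eq_or_lt_of_le hcI.1 with h' | h'
      · have h1 := hloc u hu t₀ ⟨le_rfl, h01⟩ hcu (by rw [h', sub_self, abs_zero]; exact hδ)
        exact h1.trans ((hself' c hcI).trans (hmono h))
      · obtain ⟨t, htS, hut⟩ := exists_lt_of_lt_csSup ⟨t₀, h0S⟩
          (show max t₀ (c - δ) < c from max_lt h' (by linarith))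
        have htc : t ≤ c := le_csSup hbdd htS
        set p := (max t₀ (c - δ) + t) / 2 with hp
        have hp1 : max t₀ (c - δ) < p := by rw [hp]; linarith
        have hp2 : p < t := by rw [hp]; linarith
        have hp3 : t₀ ≤ p := (le_max_left _ _).trans hp1.le
        have hp4 : c - δ < p := (le_max_right _ _).trans_lt hp1
        have hpc : |p - c| < δ := by rw [abs_lt]; constructor <;> linarith
        have h1 := hloc u hu p ⟨hp3, hp2.le.trans htS.1.2⟩ hcu hpc
        have h2 := htS.2 p ⟨hp3, hp2.le⟩
        have h3 := hself c hcI p (by linarith)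
        have h4 := abs_sub_le (k u) (k p) (k t₀)
        have h5 := hmono h
        linarith
  have hc1 : c = t₁ := by
    by_contra hne
    have hlt : c < t₁ := lt_of_le_of_ne hcI.2 hne
    set u := min t₁ (c + δ / 2) with hu
    have hu1 : c < u := lt_min hlt (by linarith)
    have huS : u ∈ S := by
      refine ⟨⟨hcI.1.trans hu1.le, min_le_left _ _⟩, fun x hx => ?_⟩
      have : x ≤ c + δ / 2 := hx.2.trans (min_le_right _ _)
      exact hext x ⟨hx.1, hx.2.trans (min_le_left _ _)⟩ (by linarith)
    exact absurd (le_csSup hbdd huS) (not_le.2 hu1)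
  have h1 := hext t₁ ⟨h01, le_rfl⟩ (by linarith)
  refine h1.trans ?_
  exact Finset.sum_le_sum_of_subset_of_nonneg (Finset.filter_subset _ _)
    fun _ _ _ => Nat.cast_nonneg _

end Edge

/-! ### Variation of the argument along an edge -/

section Edge

open Polynomial Filter Topology

/-- The sum of the arguments of `(y - z) / (y₀ - z)` over the roots `z` of `Q(t, ·)`. -/
noncomputable def argSum (Q : ℂ[X][X]) (y₀ : ℝ) (y : ℝ → ℝ) (t : ℝ) : ℝ :=
  ((specialize Q t).roots.map fun z => arg (((y t : ℂ) - z) / ((y₀ : ℂ) - z))).sum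

/-- Arguments from non-real roots are continuous at τ, and each real root contributes at most π in
absolute value, whatever happens nearby. Hence W is the sum over the non-real roots at τ. The roots
need no continuous labelling: a sequence violating the bound has a subsequence whose root tuples
converge to the roots at τ. -/
theorem exists_argSum_near (Q : ℂ[X][X]) {t₀ t₁ : ℝ}
    (hlc : ∀ t ∈ Set.Icc t₀ t₁, Q.leadingCoeff.eval (t : ℂ) ≠ 0)
    {y : ℝ → ℝ} (hy : ContinuousOn y (Set.Icc t₀ t₁)) {y₀ : ℝ}
    (hne : ∀ t ∈ Set.Icc t₀ t₁, (specialize Q t).eval (y₀ : ℂ) ≠ 0)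
    {τ : ℝ} (hτ : τ ∈ Set.Icc t₀ t₁) :
    ∃ W : ℝ, ∀ ε > 0, ∀ᶠ t in 𝓝[Set.Icc t₀ t₁] τ,
      |argSum Q y₀ y t - W| ≤ Real.pi * realRootCount Q τ + ε := by
  classical
  set φ : ℂ → ℝ := fun z => arg (((y τ : ℂ) - z) / ((y₀ : ℂ) - z)) with hφ
  refine ⟨(((specialize Q τ).roots.filter fun z => z.im ≠ 0).map φ).sum, fun ε hε => ?_⟩
  by_contra hcon
  obtain ⟨u, hu, huW⟩ := exists_seq_forall_of_frequently (Filter.not_eventually.1 hcon)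
  rw [tendsto_nhdsWithin_iff] at hu
  obtain ⟨N, hN⟩ := eventually_atTop.1 hu.2
  set u' : ℕ → ℝ := fun n => u (n + N) with hu'
  have hu'I : ∀ n, u' n ∈ Set.Icc t₀ t₁ := fun n => hN _ (Nat.le_add_left _ _)
  have hu'τ : Tendsto u' atTop (𝓝 τ) := (tendsto_add_atTop_iff_nat N).2 hu.1
  choose Y hY using fun n => exists_tuple_roots Q (u' n) (hlc _ (hu'I n))
  have hK : IsCompact ((fun t : ℝ => (t : ℂ)) '' Set.Icc t₀ t₁) :=
    isCompact_Icc.image Complex.continuous_ofReal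
  obtain ⟨R, hR⟩ := exists_bound_roots_specialize Q hK (by
    rintro _ ⟨t, ht, rfl⟩
    exact hlc t ht)
  have hR0 : ∀ n, Y n ∈ Metric.closedBall (0 : Fin Q.natDegree → ℂ) (max R 0) := by
    intro n
    rw [mem_closedBall_zero_iff, pi_norm_le_iff_of_nonneg (le_max_right _ _)]
    intro j
    refine (hR (u' n) ⟨_, hu'I n, rfl⟩ _ ?_).trans (le_max_left _ _)
    rw [hY n, Multiset.mem_map]
    exact ⟨j, Finset.mem_univ j, rfl⟩
  obtain ⟨Z, -, ψ, hψ, hZ⟩ := tendsto_subseq_of_bounded Metric.isBounded_closedBall hR0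
  rw [tendsto_pi_nhds] at hZ
  have hvτ : Tendsto (fun n => u' (ψ n)) atTop (𝓝 τ) := hu'τ.comp hψ.tendsto_atTop
  have hvτc : Tendsto (fun n => ((u' (ψ n) : ℝ) : ℂ)) atTop (𝓝 (τ : ℂ)) :=
    (Complex.continuous_ofReal.tendsto τ).comp hvτ
  have hroots : (specialize Q τ).roots = Finset.univ.val.map Z := by
    refine roots_specialize_of_eval_eq Q τ (hlc τ hτ) Z fun z => ?_
    have h1 : Tendsto (fun n => (specialize Q (u' (ψ n) : ℝ)).eval z) atTop
        (𝓝 ((specialize Q τ).eval z)) :=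
      ((continuous_eval_specialize Q z).tendsto _).comp hvτc
    have h2 : Tendsto (fun n => Q.leadingCoeff.eval ((u' (ψ n) : ℝ) : ℂ) *
        ∏ j, (z - Y (ψ n) j)) atTop (𝓝 (Q.leadingCoeff.eval (τ : ℂ) * ∏ j, (z - Z j))) := by
      refine Tendsto.mul ?_ (tendsto_finsetProd _ fun j _ => (hZ j).const_sub z)
      exact (Q.leadingCoeff.continuous.tendsto _).comp hvτc
    refine tendsto_nhds_unique h1 (h2.congr fun n => ?_)
    exact (eval_specialize_eq_prod Q _ (hlc _ (hu'I _)) _ (hY _) z).symm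
  have hyv : Tendsto (fun n => ((y (u' (ψ n)) : ℝ) : ℂ)) atTop (𝓝 (y τ : ℂ)) := by
    refine (Complex.continuous_ofReal.tendsto _).comp ?_
    exact (hy τ hτ).tendsto.comp (tendsto_nhdsWithin_iff.2 ⟨hvτ, Eventually.of_forall fun n => hu'I _⟩)
  have hZ0 : ∀ j, (y₀ : ℂ) - Z j ≠ 0 := by
    intro j h0
    apply hne τ hτ
    rw [eval_specialize_eq_prod Q _ (hlc τ hτ) Z hroots]
    rw [Finset.prod_eq_zero (Finset.mem_univ j) h0, mul_zero]
  set g : ℕ → Fin Q.natDegree → ℝ := fun n j =>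
    arg (((y (u' (ψ n)) : ℝ) - Y (ψ n) j) / ((y₀ : ℂ) - Y (ψ n) j)) with hg
  have hgt : ∀ j, (Z j).im ≠ 0 → Tendsto (fun n => g n j) atTop (𝓝 (φ (Z j))) := by
    intro j hj
    have hca := continuousAt_arg (div_sub_mem_slitPlane (y := y τ) (y₀ := y₀) hj)
    refine hca.tendsto.comp (Tendsto.div (hyv.sub (hZ j)) ((hZ j).const_sub _) (hZ0 j))
  set A := Finset.univ.filter fun j => (Z j).im ≠ 0 with hA
  have hsum : Tendsto (fun n => ∑ j ∈ A, g n j) atTop (𝓝 (∑ j ∈ A, φ (Z j))) :=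
    tendsto_finsetSum _ fun j hj => hgt j (Finset.mem_filter.1 hj).2
  have hWeq : (((specialize Q τ).roots.filter fun z => z.im ≠ 0).map φ).sum =
      ∑ j ∈ A, φ (Z j) := by
    rw [hroots, Multiset.filter_map, Multiset.map_map]
    rfl
  obtain ⟨n, hn⟩ := (Metric.tendsto_nhds.1 hsum ε hε).exists
  have hbad := huW (ψ n + N)
  apply hbad
  have hv : argSum Q y₀ y (u (ψ n + N)) = ∑ j, g n j := by
    have := hY (ψ n)
    rw [argSum, show u (ψ n + N) = u' (ψ n) from rfl, this, Multiset.map_map]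
    rfl
  rw [hv, hWeq, ← Finset.sum_filter_add_sum_filter_not Finset.univ (fun j => (Z j).im ≠ 0)]
  rw [Real.dist_eq] at hn
  have hreal : |∑ j ∈ Finset.univ.filter (fun j => ¬ (Z j).im ≠ 0), g n j| ≤
      Real.pi * realRootCount Q τ := by
    refine (Finset.abs_sum_le_sum_abs _ _).trans ?_
    refine (Finset.sum_le_card_nsmul _ _ Real.pi fun j _ => abs_arg_le_pi _).trans ?_
    rw [realRootCount_eq_card Q τ Z hroots]
    simp only [not_not, nsmul_eq_mul]
    rw [mul_comm]
  calc _ = |(∑ j ∈ A, g n j - ∑ j ∈ A, φ (Z j)) +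
        ∑ j ∈ Finset.univ.filter (fun j => ¬ (Z j).im ≠ 0), g n j| := by
        congr 1; rw [hA]; ring
    _ ≤ _ := (abs_add_le _ _).trans (by linarith)

/-- The variation of the argument of `Q(t, y(t)) / Q(t, y₀)` along a loop in the second variable
`y` is bounded by the number of real zeros of `Q`. -/
theorem abs_arg_variation_le (Q : ℂ[X][X]) (a : ℕ) (ha : ∀ k, (Q.coeff k).natDegree ≤ a)
    (hres : conjResultant Q ≠ 0) {t₀ t₁ : ℝ} (h01 : t₀ ≤ t₁)
    (hlc : ∀ t ∈ Set.Icc t₀ t₁, Q.leadingCoeff.eval (t : ℂ) ≠ 0)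
    {y : ℝ → ℝ} (hy : ContinuousOn y (Set.Icc t₀ t₁)) {y₀ : ℝ} (hy0 : y t₀ = y₀) (hy1 : y t₁ = y₀)
    (hne : ∀ t ∈ Set.Icc t₀ t₁, (specialize Q t).eval (y₀ : ℂ) ≠ 0)
    (hne' : ∀ t ∈ Set.Icc t₀ t₁, (specialize Q t).eval (y t : ℂ) ≠ 0)
    {θ : ℝ → ℝ} (hθ : ContinuousOn θ (Set.Icc t₀ t₁))
    (hr : ∀ t ∈ Set.Icc t₀ t₁, (specialize Q t).eval (y t : ℂ) / (specialize Q t).eval (y₀ : ℂ) =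
      ‖(specialize Q t).eval (y t : ℂ) / (specialize Q t).eval (y₀ : ℂ)‖ * exp (θ t * I)) :
    |θ t₁ - θ t₀| ≤ 2 * Real.pi * (2 * a * Q.natDegree : ℕ) := by
  classical
  -- `θ` and `argSum` are both arguments of the same nonzero quotient.
  have hint : ∀ t ∈ Set.Icc t₀ t₁, ∃ k : ℤ, θ t - argSum Q y₀ y t = k * (2 * Real.pi) := by
    intro t ht
    obtain ⟨Y, hY⟩ := exists_tuple_roots Q t (hlc t ht)
    have h1 : (specialize Q t).eval (y t : ℂ) / (specialize Q t).eval (y₀ : ℂ) =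
        ∏ j, (((y t : ℂ) - Y j) / ((y₀ : ℂ) - Y j)) := by
      rw [eval_specialize_eq_prod Q t (hlc t ht) Y hY, eval_specialize_eq_prod Q t (hlc t ht) Y hY,
        mul_div_mul_left _ _ (hlc t ht), Finset.prod_div_distrib]
    have h2 : argSum Q y₀ y t = ∑ j, arg (((y t : ℂ) - Y j) / ((y₀ : ℂ) - Y j)) := by
      rw [argSum, hY, Multiset.map_map]; rfl
    have h3 := hr t ht
    have h0 : ‖(specialize Q t).eval (y t : ℂ) / (specialize Q t).eval (y₀ : ℂ)‖ ≠ 0 :=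
      norm_ne_zero_iff.2 (div_ne_zero (hne' t ht) (hne t ht))
    have h4 : (specialize Q t).eval (y t : ℂ) / (specialize Q t).eval (y₀ : ℂ) =
        ‖(specialize Q t).eval (y t : ℂ) / (specialize Q t).eval (y₀ : ℂ)‖ *
          exp (argSum Q y₀ y t * I) := by
      rw [h1, h2, norm_prod]
      push_cast
      rw [Finset.sum_mul, Complex.exp_sum, ← Finset.prod_mul_distrib]
      exact Finset.prod_congr rfl fun j _ => (norm_mul_exp_arg_mul_I _).symm
    have h5 := mul_left_cancel₀ (Complex.ofReal_ne_zero.2 h0) (h4.symm.trans h3)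
    rw [Complex.exp_eq_exp_iff_exists_int] at h5
    obtain ⟨n, hn⟩ := h5
    refine ⟨-n, ?_⟩
    have h6 : ((argSum Q y₀ y t : ℝ) : ℂ) = θ t + n * (2 * Real.pi) := by
      have hI := I_ne_zero
      apply mul_right_cancel₀ hI
      rw [hn]; ring
    have h7 : argSum Q y₀ y t = θ t + n * (2 * Real.pi) := by exact_mod_cast h6
    push_cast
    linarith
  set k : ℝ → ℝ := fun t => (θ t - argSum Q y₀ y t) / (2 * Real.pi) with hk
  have hpi := Real.pi_pos
  have hkint : ∀ t ∈ Set.Icc t₀ t₁, ∃ n : ℤ, k t = n := by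
    intro t ht
    obtain ⟨n, hn⟩ := hint t ht
    exact ⟨n, by rw [hk]; simp only; rw [hn]; field_simp⟩
  have hfin := finite_realRootCount_ne_zero Q hres
  set T : Finset ℝ := hfin.toFinset.filter (· ∈ Set.Icc t₀ t₁) with hT
  have hmain : |k t₁ - k t₀| ≤ ∑ t ∈ T, (realRootCount Q t : ℝ) := by
    refine abs_sub_le_sum_of_local h01 k (fun t => realRootCount Q t) T ?_ ?_
    · intro t ht h0
      rw [hT, Finset.mem_filter, Set.Finite.mem_toFinset]
      exact ⟨⟨hlc t ht, h0⟩, ht⟩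
    · intro τ hτ
      obtain ⟨W, hW⟩ := exists_argSum_near Q hlc hy hne hτ
      -- With tolerance 1 for both `argSum` and `θ`, the difference 2π(k u - k u') is below 2π ·
      -- `realRootCount` + 4. Since 4 < 2π and `k` is integer-valued, `k` oscillates by at most
      -- `realRootCount`.
      have h1 := hW 1 one_pos
      have h2 : ∀ᶠ t in 𝓝[Set.Icc t₀ t₁] τ, |θ t - θ τ| < 1 := by
        have := Metric.tendsto_nhds.1 (hθ τ hτ).tendsto 1 one_pos
        simpa [Real.dist_eq] using this
      obtain ⟨δ, hδ, hδ'⟩ := Metric.mem_nhdsWithin_iff.1 (h1.and h2)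
      refine ⟨δ, hδ, fun u hu u' hu' hud hud' => ?_⟩
      obtain ⟨a1, a2⟩ := hδ' ⟨by simpa [Real.dist_eq] using hud, hu⟩
      obtain ⟨b1, b2⟩ := hδ' ⟨by simpa [Real.dist_eq] using hud', hu'⟩
      obtain ⟨n, hn⟩ := hkint u hu
      obtain ⟨n', hn'⟩ := hkint u' hu'
      have h3 : (2 * Real.pi) * (k u - k u') =
          (θ u - θ u') - (argSum Q y₀ y u - argSum Q y₀ y u') := by
        rw [hk]; field_simp; ring
      have h4 : |(2 * Real.pi) * (k u - k u')| < (2 * Real.pi) * (realRootCount Q τ + 1) := by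
        rw [h3]
        rw [abs_le] at a1 b1
        rw [abs_lt] at a2 b2 ⊢
        have := Real.pi_gt_three
        constructor <;> linarith [a1.1, a1.2, b1.1, b1.2, a2.1, a2.2, b2.1, b2.2]
      rw [abs_mul, abs_of_pos (by positivity)] at h4
      have h5 := lt_of_mul_lt_mul_left h4 (by positivity)
      rw [hn, hn'] at h5 ⊢
      have h6 : |n - n'| < (realRootCount Q τ : ℤ) + 1 := by exact_mod_cast h5
      exact_mod_cast Int.lt_add_one_iff.1 h6
  -- At the ends all factors equal 1, so the variation of `θ` is exactly 2π times that of `k`.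
  have hvend : ∀ t ∈ Set.Icc t₀ t₁, y t = y₀ → argSum Q y₀ y t = 0 := by
    intro t ht hyt
    rw [argSum, hyt]
    apply Multiset.sum_eq_zero
    intro x hx
    obtain ⟨z, hz, rfl⟩ := Multiset.mem_map.1 hx
    have hz0 : (y₀ : ℂ) - z ≠ 0 := by
      intro h0
      apply hne t ht
      rw [sub_eq_zero.1 h0]
      exact isRoot_of_mem_roots hz
    rw [div_self hz0, arg_one]
  have hk' : (2 * Real.pi) * (k t₁ - k t₀) = θ t₁ - θ t₀ := by
    rw [hk]
    simp only
    rw [hvend t₀ ⟨le_rfl, h01⟩ hy0, hvend t₁ ⟨h01, le_rfl⟩ hy1]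
    field_simp
    ring
  rw [← hk', abs_mul, abs_of_pos (by positivity)]
  refine mul_le_mul_of_nonneg_left (hmain.trans ?_) (by positivity)
  have := sum_realRootCount_le Q a ha hres T fun t ht => hlc t (Finset.mem_filter.1 ht).2
  exact_mod_cast this

end Edge

/-! ### Integrals over the boundary of a rectangle -/

section RectIntegral

open Filter Topology MeasureTheory

/-- The integral of `F` along the positively oriented boundary of the rectangle
`[a, b] × [c, d]`. -/
noncomputable def rectIntegral (F : ℂ → ℂ) (a b c d : ℝ) : ℂ :=
  (∫ x : ℝ in a..b, F (x + c * I)) - (∫ x : ℝ in a..b, F (x + d * I)) +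
    I * (∫ y : ℝ in c..d, F (b + y * I)) - I * (∫ y : ℝ in c..d, F (a + y * I))

/-- The boundary of the rectangle `[a, b] × [c, d]`. -/
def rectBoundary (a b c d : ℝ) : Set ℂ :=
  (Set.Icc a b ×ℂ Set.Icc c d) \ (Set.Ioo a b ×ℂ Set.Ioo c d)

variable {a b c d : ℝ}

theorem mem_rectBoundary_bottom (hcd : c ≤ d) {x : ℝ} (hx : x ∈ Set.Icc a b) :
    (x + c * I : ℂ) ∈ rectBoundary a b c d := by
  simp [rectBoundary, mem_reProdIm, hx.1, hx.2, hcd]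

theorem mem_rectBoundary_top (hcd : c ≤ d) {x : ℝ} (hx : x ∈ Set.Icc a b) :
    (x + d * I : ℂ) ∈ rectBoundary a b c d := by
  simp [rectBoundary, mem_reProdIm, hx.1, hx.2, hcd]

theorem mem_rectBoundary_right (hab : a ≤ b) {y : ℝ} (hy : y ∈ Set.Icc c d) :
    (b + y * I : ℂ) ∈ rectBoundary a b c d := by
  simp [rectBoundary, mem_reProdIm, hy.1, hy.2, hab]

theorem mem_rectBoundary_left (hab : a ≤ b) {y : ℝ} (hy : y ∈ Set.Icc c d) :
    (a + y * I : ℂ) ∈ rectBoundary a b c d := by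
  simp [rectBoundary, mem_reProdIm, hy.1, hy.2, hab]

theorem rectBoundary_cases {z : ℂ} (hz : z ∈ rectBoundary a b c d) :
    (z.re = a ∨ z.re = b ∨ z.im = c ∨ z.im = d) ∧ z.re ∈ Set.Icc a b ∧ z.im ∈ Set.Icc c d := by
  obtain ⟨⟨h1, h2⟩, h3⟩ := hz
  refine ⟨?_, h1, h2⟩
  by_contra hcon
  push Not at hcon
  obtain ⟨n1, n2, n3, n4⟩ := hcon
  exact h3 ⟨⟨lt_of_le_of_ne h1.1 n1.symm, lt_of_le_of_ne h1.2 n2⟩,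
    ⟨lt_of_le_of_ne h2.1 n3.symm, lt_of_le_of_ne h2.2 n4⟩⟩

theorem isCompact_rectBoundary : IsCompact (rectBoundary a b c d) :=
  (isCompact_Icc.reProdIm isCompact_Icc).diff (isOpen_Ioo.reProdIm isOpen_Ioo)

theorem rectIntegral_intervalIntegrable (hab : a ≤ b) (hcd : c ≤ d) {F : ℂ → ℂ}
    (hF : ContinuousOn F (rectBoundary a b c d)) :
    IntervalIntegrable (fun x : ℝ => F (x + c * I)) volume a b ∧
    IntervalIntegrable (fun x : ℝ => F (x + d * I)) volume a b ∧
    IntervalIntegrable (fun y : ℝ => F (b + y * I)) volume c d ∧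
    IntervalIntegrable (fun y : ℝ => F (a + y * I)) volume c d := by
  refine ⟨?_, ?_, ?_, ?_⟩ <;> refine ContinuousOn.intervalIntegrable ?_
  · rw [Set.uIcc_of_le hab]
    exact hF.comp (by fun_prop) fun x hx => mem_rectBoundary_bottom hcd hx
  · rw [Set.uIcc_of_le hab]
    exact hF.comp (by fun_prop) fun x hx => mem_rectBoundary_top hcd hx
  · rw [Set.uIcc_of_le hcd]
    exact hF.comp (by fun_prop) fun x hx => mem_rectBoundary_right hab hx
  · rw [Set.uIcc_of_le hcd]
    exact hF.comp (by fun_prop) fun x hx => mem_rectBoundary_left hab hx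

theorem rectIntegral_add (hab : a ≤ b) (hcd : c ≤ d) {F G : ℂ → ℂ}
    (hF : ContinuousOn F (rectBoundary a b c d)) (hG : ContinuousOn G (rectBoundary a b c d)) :
    rectIntegral (fun z => F z + G z) a b c d = rectIntegral F a b c d + rectIntegral G a b c d := by
  obtain ⟨f1, f2, f3, f4⟩ := rectIntegral_intervalIntegrable hab hcd hF
  obtain ⟨g1, g2, g3, g4⟩ := rectIntegral_intervalIntegrable hab hcd hG
  simp only [rectIntegral]
  rw [intervalIntegral.integral_add f1 g1, intervalIntegral.integral_add f2 g2,
    intervalIntegral.integral_add f3 g3, intervalIntegral.integral_add f4 g4]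
  ring

theorem rectIntegral_const_mul (k : ℂ) (F : ℂ → ℂ) :
    rectIntegral (fun z => k * F z) a b c d = k * rectIntegral F a b c d := by
  simp only [rectIntegral, intervalIntegral.integral_const_mul]
  ring

theorem rectIntegral_finsetSum (hab : a ≤ b) (hcd : c ≤ d) {ι : Type*} (s : Finset ι)
    {F : ι → ℂ → ℂ} (hF : ∀ i ∈ s, ContinuousOn (F i) (rectBoundary a b c d)) :
    rectIntegral (fun z => ∑ i ∈ s, F i z) a b c d = ∑ i ∈ s, rectIntegral (F i) a b c d := by
  classical
  induction s using Finset.induction_on with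
  | empty => simp [rectIntegral]
  | insert i s hi ih =>
    simp only [Finset.sum_insert hi]
    rw [rectIntegral_add hab hcd (hF i (Finset.mem_insert_self i s))
      (continuousOn_finsetSum s fun j hj => hF j (Finset.mem_insert_of_mem hj)),
      ih fun j hj => hF j (Finset.mem_insert_of_mem hj)]

theorem rectIntegral_congr (hab : a ≤ b) (hcd : c ≤ d) {F G : ℂ → ℂ}
    (h : Set.EqOn F G (rectBoundary a b c d)) : rectIntegral F a b c d = rectIntegral G a b c d := by
  simp only [rectIntegral]
  congr 1
  · congr 1
    · congr 1
      · refine intervalIntegral.integral_congr fun x hx => ?_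
        rw [Set.uIcc_of_le hab] at hx
        exact h (mem_rectBoundary_bottom hcd hx)
      · refine intervalIntegral.integral_congr fun x hx => ?_
        rw [Set.uIcc_of_le hab] at hx
        exact h (mem_rectBoundary_top hcd hx)
    · congr 1
      refine intervalIntegral.integral_congr fun x hx => ?_
      rw [Set.uIcc_of_le hcd] at hx
      exact h (mem_rectBoundary_right hab hx)
  · congr 1
    refine intervalIntegral.integral_congr fun x hx => ?_
    rw [Set.uIcc_of_le hcd] at hx
    exact h (mem_rectBoundary_left hab hx)

theorem rectIntegral_eq_zero (hab : a ≤ b) (hcd : c ≤ d) {F : ℂ → ℂ}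
    (hF : DifferentiableOn ℂ F (Set.Icc a b ×ℂ Set.Icc c d)) : rectIntegral F a b c d = 0 := by
  have := integral_boundary_rect_eq_zero_of_differentiableOn F ⟨a, c⟩ ⟨b, d⟩
    (by simpa [Set.uIcc_of_le hab, Set.uIcc_of_le hcd] using hF)
  simpa [rectIntegral] using this

theorem log_I_mul_of_re_pos {w : ℂ} (hw : 0 < w.re) : log (I * w) = log w + Real.pi / 2 * I := by
  have h0 : w ≠ 0 := by rintro rfl; simp at hw
  have h1 := abs_lt.1 ((abs_arg_lt_pi_div_two_iff).2 (Or.inl hw))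
  rw [Complex.log_mul I_ne_zero h0, log_I, add_comm]
  rw [arg_I]
  constructor <;> linarith [Real.pi_pos, h1.1, h1.2]

theorem log_neg_I_mul_of_re_pos {w : ℂ} (hw : 0 < w.re) :
    log (-I * w) = log w - Real.pi / 2 * I := by
  have h0 : w ≠ 0 := by rintro rfl; simp at hw
  have h1 := abs_lt.1 ((abs_arg_lt_pi_div_two_iff).2 (Or.inl hw))
  rw [Complex.log_mul (neg_ne_zero.2 I_ne_zero) h0, log_neg_I]
  · ring
  rw [arg_neg_I]
  constructor <;> linarith [Real.pi_pos, h1.1, h1.2]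

/-- The integral of `μ / (z - p)` along a segment that a rotation by `u` moves, relative to `p`,
to the right half-plane. -/
theorem integral_inv_sub_eq_log (u ζ μ p : ℂ) (hu : u ≠ 0) {s t : ℝ}
    (h : ∀ x ∈ Set.uIcc s t, 0 < (u * (ζ + x * μ - p)).re) :
    ∫ x : ℝ in s..t, μ * (ζ + x * μ - p)⁻¹ =
      log (u * (ζ + t * μ - p)) - log (u * (ζ + s * μ - p)) := by
  have hne : ∀ x ∈ Set.uIcc s t, ζ + x * μ - p ≠ 0 := by
    intro x hx h0
    have := h x hx
    rw [h0] at this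
    simp at this
  refine intervalIntegral.integral_eq_sub_of_hasDerivAt
    (f := fun x : ℝ => log (u * (ζ + x * μ - p))) (fun x hx => ?_) ?_
  · have h1 : HasDerivAt (fun x : ℝ => u * (ζ + x * μ - p)) (u * μ) x := by
      have h2 : HasDerivAt (fun x : ℝ => (x : ℂ)) 1 x := ofRealCLM.hasDerivAt
      have := (((h2.mul_const μ).const_add ζ).sub_const p).const_mul u
      simpa using this
    have h3 := h1.clog_real (Or.inl (h x hx))
    rwa [mul_div_mul_left _ _ hu, div_eq_mul_inv] at h3
  · refine ContinuousOn.intervalIntegrable ?_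
    exact continuousOn_const.mul (ContinuousOn.inv₀ (by fun_prop) hne)

/-- On each edge, z - p lies in an open half-plane, which one of the rotations I, -I, 1, -1 takes to
the right half-plane; there log is a primitive. The logarithms at the corners cancel up to four
quarter turns π/2 · I. -/
theorem rectIntegral_inv_sub {p : ℂ} (hp : p ∈ Set.Ioo a b ×ℂ Set.Ioo c d) :
    rectIntegral (fun z => (z - p)⁻¹) a b c d = 2 * Real.pi * I := by
  obtain ⟨⟨h1, h2⟩, ⟨h3, h4⟩⟩ := mem_reProdIm.1 hp
  have e1 := integral_inv_sub_eq_log I (c * I) 1 p I_ne_zero (s := a) (t := b)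
    (fun x _ => by simp; linarith)
  have e2 := integral_inv_sub_eq_log (-I) (d * I) 1 p (neg_ne_zero.2 I_ne_zero) (s := a) (t := b)
    (fun x _ => by simp; linarith)
  have e3 := integral_inv_sub_eq_log 1 b I p one_ne_zero (s := c) (t := d)
    (fun x _ => by simp; linarith)
  have e4 := integral_inv_sub_eq_log (-1) a I p (by simp) (s := c) (t := d)
    (fun x _ => by simp; linarith)
  rw [intervalIntegral.integral_const_mul] at e1 e2 e3 e4
  have k1 : log (I * (c * I + b * 1 - p)) = log (b + c * I - p) + Real.pi / 2 * I := by
    rw [← log_I_mul_of_re_pos (by simp; linarith)]; ring_nf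
  have k2 : log (I * (c * I + a * 1 - p)) = log (-1 * (a + c * I - p)) - Real.pi / 2 * I := by
    rw [← log_neg_I_mul_of_re_pos (by simp; linarith)]; ring_nf
  have k3 : log (-I * (d * I + b * 1 - p)) = log (b + d * I - p) - Real.pi / 2 * I := by
    rw [← log_neg_I_mul_of_re_pos (by simp; linarith)]; ring_nf
  have k4 : log (-I * (d * I + a * 1 - p)) = log (-1 * (a + d * I - p)) + Real.pi / 2 * I := by
    rw [← log_I_mul_of_re_pos (by simp; linarith)]; ring_nf
  rw [k1, k2] at e1
  rw [k3, k4] at e2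
  simp only [one_mul, mul_one] at e1 e2 e3 e4
  rw [rectIntegral, e3, e4]
  simp only [add_comm (_ : ℂ) (c * I), add_comm (_ : ℂ) (d * I)] at e1 e2 ⊢
  rw [e1, e2]
  ring

theorem rectIntegral_inv_sub_of_notMem (hab : a ≤ b) (hcd : c ≤ d) {p : ℂ}
    (hp : p ∉ Set.Icc a b ×ℂ Set.Icc c d) :
    rectIntegral (fun z => (z - p)⁻¹) a b c d = 0 := by
  refine rectIntegral_eq_zero hab hcd fun z hz => DifferentiableAt.differentiableWithinAt ?_
  have : z - p ≠ 0 := fun h => hp (by rwa [← sub_eq_zero.1 h])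
  fun_prop (disch := assumption)

end RectIntegral

/-! ### The argument principle -/

section ArgumentPrinciple

open Filter Topology MeasureTheory

variable {a b c d : ℝ}

theorem Icc_reProdIm_subset_union :
    (Set.Icc a b ×ℂ Set.Icc c d : Set ℂ) ⊆ rectBoundary a b c d ∪ (Set.Ioo a b ×ℂ Set.Ioo c d) :=
  fun z hz => by
    by_cases h : z ∈ (Set.Ioo a b ×ℂ Set.Ioo c d : Set ℂ)
    · exact Or.inr h
    · exact Or.inl ⟨hz, h⟩

/-- The **argument principle** on a rectangle. -/
theorem rectIntegral_logDeriv (hab : a ≤ b) (hcd : c ≤ d) {r : ℂ → ℂ} (hr : Meromorphic r)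
    (htop : ∀ z, meromorphicOrderAt r z ≠ ⊤)
    (hB : ∀ z ∈ rectBoundary a b c d, AnalyticAt ℂ r z ∧ r z ≠ 0)
    (A : Finset ℂ) (hA : ∀ z ∈ A, z ∈ (Set.Ioo a b ×ℂ Set.Ioo c d : Set ℂ))
    (hA' : ∀ z ∈ (Set.Ioo a b ×ℂ Set.Ioo c d : Set ℂ), meromorphicOrderAt r z ≠ 0 → z ∈ A) :
    rectIntegral (logDeriv r) a b c d =
      2 * Real.pi * I * (∑ z ∈ A, (meromorphicOrderAt r z).untop₀ : ℤ) := by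
  classical
  -- The factorization below holds codiscretely within `U`, so `U` is chosen as a ball with the
  -- closed rectangle in its interior.
  obtain ⟨R, hR⟩ := (isCompact_Icc.reProdIm isCompact_Icc :
    IsCompact (Set.Icc a b ×ℂ Set.Icc c d : Set ℂ)).isBounded.subset_ball 0
  set U := Metric.closedBall (0 : ℂ) R with hU
  have hKU : (Set.Icc a b ×ℂ Set.Icc c d : Set ℂ) ⊆ U := hR.trans Metric.ball_subset_closedBall
  have hKn : ∀ z ∈ (Set.Icc a b ×ℂ Set.Icc c d : Set ℂ), U ∈ 𝓝 z := fun z hz =>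
    mem_of_superset (Metric.isOpen_ball.mem_nhds (hR hz)) Metric.ball_subset_closedBall
  have hrU : MeromorphicOn r U := fun z _ => hr z
  set D := MeromorphicOn.divisor r U with hD
  have hfin : D.support.Finite := D.finiteSupport (isCompact_closedBall 0 R)
  obtain ⟨g, hg, hg0, hrg⟩ := hrU.extract_zeros_poles (fun u => htop u) hfin
  set S := hfin.toFinset with hS
  have hDapp : ∀ z ∈ U, D z = (meromorphicOrderAt r z).untop₀ := fun z hz =>
    MeromorphicOn.divisor_apply hrU hz
  have hprod : (∏ᶠ u, (fun z : ℂ => z - u) ^ D u) • g =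
      fun z => (∏ u ∈ S, (z - u) ^ D u) * g z := by
    rw [Function.FactorizedRational.finprod_eq_fun hfin]
    ext z
    simp only [Pi.smul_apply', smul_eq_mul]
    congr 1
    refine finprod_eq_prod_of_mulSupport_subset _ fun u hu => ?_
    rw [Function.mem_mulSupport] at hu
    rw [hS, Set.Finite.coe_toFinset, Function.mem_support]
    intro h0
    exact hu (by rw [h0, zpow_zero])
  rw [← hD, hprod] at hrg
  have hBK : rectBoundary a b c d ⊆ (Set.Icc a b ×ℂ Set.Icc c d : Set ℂ) := Set.sdiff_subset
  have hSB : ∀ z ∈ rectBoundary a b c d, ∀ u ∈ S, z - u ≠ 0 := by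
    intro z hz u hu h0
    obtain rfl : z = u := sub_eq_zero.1 h0
    rw [hS, Set.Finite.mem_toFinset, Function.mem_support, hDapp z (hKU (hBK hz))] at hu
    apply hu
    obtain ⟨h1, h2⟩ := hB z hz
    rw [h1.meromorphicOrderAt_eq, h1.analyticOrderAt_eq_zero.2 h2]
    rfl
  have hlog : ∀ z ∈ rectBoundary a b c d,
      logDeriv r z = ∑ u ∈ S, (D u : ℂ) * (z - u)⁻¹ + logDeriv g z := by
    intro z hz
    have hzU := hKU (hBK hz)
    have hgz := hg z hzU
    have hpz : ∀ u ∈ S, AnalyticAt ℂ (fun z : ℂ => (z - u) ^ D u) z := fun u hu =>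
      AnalyticAt.zpow (by fun_prop) (hSB z hz u hu)
    have hpz' : AnalyticAt ℂ (fun z : ℂ => ∏ u ∈ S, (z - u) ^ D u) z :=
      Finset.analyticAt_fun_prod _ hpz
    have h1 : r =ᶠ[𝓝[≠] z] fun z => (∏ u ∈ S, (z - u) ^ D u) * g z := by
      have h2 := mem_codiscreteWithin_iff_forall_mem_nhdsNE.1 hrg z hzU
      filter_upwards [h2, mem_nhdsWithin_of_mem_nhds (hKn z (hBK hz))] with w hw hwU
      exact hw.resolve_right fun h => h hwU
    -- On the boundary both sides are continuous, which upgrades equality on a punctured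
    -- neighbourhood to equality on a full one, as the logarithmic derivative at `z` requires.
    have h3 := ((hB z hz).1.continuousAt.eventuallyEq_nhds_iff_eventuallyEq_nhdsNE
      (hpz'.mul hgz).continuousAt).1 h1
    have h4 : logDeriv r z = logDeriv (fun z => (∏ u ∈ S, (z - u) ^ D u) * g z) z :=
      (logDeriv_congr_nhds h3).self_of_nhds
    rw [h4, logDeriv_mul z (Finset.prod_ne_zero_iff.2 fun u hu => zpow_ne_zero _ (hSB z hz u hu))
      (hg0 ⟨z, hzU⟩) hpz'.differentiableAt hgz.differentiableAt,
      logDeriv_prod (f := fun (u z : ℂ) => (z - u) ^ D u)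
        (fun u hu => zpow_ne_zero _ (hSB z hz u hu)) fun u hu => (hpz u hu).differentiableAt]
    congr 1
    refine Finset.sum_congr rfl fun u hu => ?_
    have h5 : DifferentiableAt ℂ (fun z : ℂ => z - u) z := by fun_prop
    rw [logDeriv_fun_zpow h5, logDeriv_apply]
    simp
  have hgK : DifferentiableOn ℂ (logDeriv g) (Set.Icc a b ×ℂ Set.Icc c d) := by
    intro z hz
    have hgz := hg z (hKU hz)
    exact (hgz.deriv.div hgz (hg0 ⟨z, hKU hz⟩)).differentiableAt.differentiableWithinAt
  have hinv : ∀ u ∈ S, ContinuousOn (fun z : ℂ => (D u : ℂ) * (z - u)⁻¹) (rectBoundary a b c d) :=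
    fun u hu => continuousOn_const.mul (ContinuousOn.inv₀ (by fun_prop) fun z hz => hSB z hz u hu)
  rw [rectIntegral_congr hab hcd hlog,
    rectIntegral_add hab hcd (continuousOn_finsetSum S hinv) (hgK.continuousOn.mono hBK),
    rectIntegral_eq_zero hab hcd hgK, add_zero, rectIntegral_finsetSum hab hcd S hinv]
  simp only [rectIntegral_const_mul]
  have hterm : ∀ u ∈ S, (D u : ℂ) * rectIntegral (fun z => (z - u)⁻¹) a b c d =
      if u ∈ A then 2 * Real.pi * I * ((meromorphicOrderAt r u).untop₀ : ℤ) else 0 := by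
    intro u hu
    have huU : u ∈ U := D.supportWithinDomain (hfin.mem_toFinset.1 hu)
    have hu0 : D u ≠ 0 := hfin.mem_toFinset.1 hu
    split_ifs with huA
    · rw [rectIntegral_inv_sub (hA u huA), hDapp u huU]
      ring
    · rw [rectIntegral_inv_sub_of_notMem hab hcd, mul_zero]
      intro huK
      rcases Icc_reProdIm_subset_union huK with h | h
      · exact hSB u h u hu (sub_self u)
      · refine huA (hA' u h fun h0 => hu0 ?_)
        rw [hDapp u huU, h0]
        rfl
  rw [Finset.sum_congr rfl hterm, ← Finset.sum_filter]
  push_cast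
  rw [Finset.mul_sum]
  refine Finset.sum_subset (fun u hu => (Finset.mem_filter.1 hu).2) fun u hu hu' => ?_
  have huU : u ∈ U := hKU ⟨Set.Ioo_subset_Icc_self (hA u hu).1, Set.Ioo_subset_Icc_self (hA u hu).2⟩
  have : D u = 0 := by
    by_contra h0
    exact hu' (Finset.mem_filter.2 ⟨hfin.mem_toFinset.2 h0, hu⟩)
  rw [← hDapp u huU, this]
  simp

/-- A nonvanishing function along a segment is the exponential of the integral of its logarithmic
derivative. -/
theorem eq_mul_exp_integral {s t : ℝ} (hst : s ≤ t) {φ φ' : ℝ → ℂ}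
    (hφ : ∀ x ∈ Set.Icc s t, HasDerivAt φ (φ' x) x) (h0 : ∀ x ∈ Set.Icc s t, φ x ≠ 0)
    (hc : ContinuousOn (fun x => φ' x / φ x) (Set.Icc s t)) :
    ∀ x ∈ Set.Icc s t, φ x = φ s * exp (∫ u in s..x, φ' u / φ u) := by
  set L : ℝ → ℂ := fun x => ∫ u in s..x, φ' u / φ u with hL
  have hint : IntegrableOn (fun x => φ' x / φ x) (Set.Icc s t) := hc.integrableOn_Icc
  have hLc : ContinuousOn L (Set.Icc s t) :=
    intervalIntegral.continuousOn_primitive_interval (by rwa [Set.uIcc_of_le hst]) |>.mono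
      (by rw [Set.uIcc_of_le hst])
  -- One-sided derivatives suffice and include the endpoint `s`, outside which nothing is assumed
  -- about the integrand.
  have hLd : ∀ x ∈ Set.Ico s t, HasDerivWithinAt L (φ' x / φ x) (Set.Ici x) x := by
    intro x hx
    have hxs : (𝓝[>] x) = 𝓝[Set.Ioo x t] x := (nhdsWithin_Ioo_eq_nhdsGT hx.2).symm
    have hsub : Set.Ioo x t ⊆ Set.Icc s t := fun u hu => ⟨hx.1.trans hu.1.le, hu.2.le⟩
    refine intervalIntegral.integral_hasDerivWithinAt_right ?_ (t := Set.Ioi x) ?_ ?_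
    · refine (hc.mono ?_).intervalIntegrable
      rw [Set.uIcc_of_le hx.1]
      exact Set.Icc_subset_Icc_right hx.2.le
    · rw [hxs]
      exact (hc.mono hsub).stronglyMeasurableAtFilter_nhdsWithin measurableSet_Ioo x
    · rw [ContinuousWithinAt, hxs]
      exact (hc x ⟨hx.1, hx.2.le⟩).mono_left (nhdsWithin_mono x hsub)
  set G : ℝ → ℂ := fun x => φ x * exp (-L x) with hG
  have hφc : ContinuousOn φ (Set.Icc s t) := fun x hx => (hφ x hx).continuousAt.continuousWithinAt
  have hGc : ContinuousOn G (Set.Icc s t) := hφc.mul hLc.neg.cexp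
  have hGd : ∀ x ∈ Set.Ico s t, HasDerivWithinAt G 0 (Set.Ici x) x := by
    intro x hx
    have h1 := (hφ x (Set.Ico_subset_Icc_self hx)).hasDerivWithinAt.mul (hLd x hx).neg.cexp
    have h2 := h0 x (Set.Ico_subset_Icc_self hx)
    have h3 : φ' x * exp (-L x) + φ x * (exp (-L x) * -(φ' x / φ x)) = 0 := by
      field_simp
      ring
    rw [← h3]
    exact h1
  have hconst : ∀ x ∈ Set.Icc s t, G x = G s := constant_of_has_deriv_right_zero hGc hGd
  intro x hx
  have h1 := hconst x hx
  have h2 : L s = 0 := by simp [hL]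
  simp only [hG, h2, neg_zero, Complex.exp_zero, mul_one] at h1
  rw [← h1, mul_assoc, ← Complex.exp_add]
  simp [hL]

end ArgumentPrinciple

/-! ### The bound for the four edges -/

section EdgeIntegral

open Polynomial Filter Topology MeasureTheory

/-- The restriction of a bivariate polynomial to the line `t ↦ ζ + t μ` in the inner variable. -/
noncomputable def edgePoly (p : ℂ[X][X]) (ζ μ : ℂ) : ℂ[X][X] :=
  p.map (compRingHom (C ζ + X * C μ))

theorem specialize_edgePoly (p : ℂ[X][X]) (ζ μ t : ℂ) :
    specialize (edgePoly p ζ μ) t = specialize p (ζ + t * μ) := by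
  rw [specialize, edgePoly, specialize, Polynomial.map_map]
  congr 1
  ext x
  · simp
  · simp [mul_comm (t : ℂ) μ]

theorem edgePoly_props (p : ℂ[X][X]) (ζ μ t : ℂ) (h : p.leadingCoeff.eval (ζ + t * μ) ≠ 0) :
    (edgePoly p ζ μ).natDegree = p.natDegree ∧
      (edgePoly p ζ μ).leadingCoeff = p.leadingCoeff.comp (C ζ + X * C μ) := by
  have h1 : (compRingHom (C ζ + X * C μ)) p.leadingCoeff ≠ 0 := by
    intro h0
    apply h
    have := congrArg (eval t) h0
    simpa only [coe_compRingHom_apply, eval_comp, eval_add, eval_mul, eval_C, eval_X,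
      eval_zero] using this
  exact ⟨natDegree_map_of_leadingCoeff_ne_zero _ h1, leadingCoeff_map_of_leadingCoeff_ne_zero _ h1⟩

theorem natDegree_coeff_edgePoly_le (p : ℂ[X][X]) (a : ℕ) (ha : ∀ k, (p.coeff k).natDegree ≤ a)
    (ζ μ : ℂ) (k : ℕ) : ((edgePoly p ζ μ).coeff k).natDegree ≤ a := by
  rw [edgePoly, coeff_map, coe_compRingHom_apply]
  refine natDegree_comp_le.trans ?_
  have h1 : (C ζ + X * C μ).natDegree ≤ 1 := by
    refine (natDegree_add_le _ _).trans (max_le (by simp) ?_)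
    exact natDegree_mul_le.trans (by simp)
  calc _ ≤ a * 1 := Nat.mul_le_mul (ha k) h1
    _ = a := mul_one a

theorem analyticAt_eval_specialize (p : ℂ[X][X]) {u v : ℂ → ℂ} {z : ℂ} (hu : AnalyticAt ℂ u z)
    (hv : AnalyticAt ℂ v z) : AnalyticAt ℂ (fun z => (specialize p (u z)).eval (v z)) z := by
  have : (fun z => (specialize p (u z)).eval (v z)) =
      fun z => ∑ k ∈ Finset.range (p.natDegree + 1), (p.coeff k).eval (u z) * v z ^ k := by
    ext z
    rw [specialize, eval_map, eval₂_eq_sum_range]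
    rfl
  rw [this]
  refine Finset.analyticAt_fun_sum _ fun k _ => AnalyticAt.mul ?_ (hv.pow k)
  have h1 : AnalyticAt ℂ (fun w => (p.coeff k).eval w) (u z) :=
    AnalyticAt.aeval_polynomial (f := fun w => w) (by fun_prop) (p.coeff k) |>.congr (by
      refine Eventually.of_forall fun w => ?_
      simp)
  exact h1.comp hu

/-- The quotient `p(z, W z) / p(z, y₀)`. -/
noncomputable def comparisonQuotient (p : ℂ[X][X]) (W : ℂ → ℂ) (y₀ : ℝ) (z : ℂ) : ℂ :=
  (specialize p z).eval (W z) / (specialize p z).eval (y₀ : ℂ)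

/-- This translates `abs_arg_variation_le` into integrals: the imaginary part of the integrated
logarithmic derivative is a continuous choice of argument. The conditions at the two ends make y a
loop based at y₀. -/
theorem abs_im_integral_logDeriv_le (p : ℂ[X][X]) (a : ℕ) (ha : ∀ k, (p.coeff k).natDegree ≤ a)
    (ζ μ : ℂ) {t₀ t₁ : ℝ} (h01 : t₀ ≤ t₁)
    (hlc : ∀ t ∈ Set.Icc t₀ t₁, p.leadingCoeff.eval (ζ + t * μ) ≠ 0)
    (hres : conjResultant (edgePoly p ζ μ) ≠ 0) {W : ℂ → ℂ} {y₀ : ℝ}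
    (hW : ∀ t ∈ Set.Icc t₀ t₁, AnalyticAt ℂ W (ζ + t * μ))
    (hWr : ∀ t ∈ Set.Icc t₀ t₁, (W (ζ + t * μ)).im = 0)
    (hW0 : W (ζ + t₀ * μ) = y₀) (hW1 : W (ζ + t₁ * μ) = y₀)
    (hf : ∀ t ∈ Set.Icc t₀ t₁, (specialize p (ζ + t * μ)).eval (W (ζ + t * μ)) ≠ 0)
    (hg : ∀ t ∈ Set.Icc t₀ t₁, (specialize p (ζ + t * μ)).eval (y₀ : ℂ) ≠ 0) :
    |(μ * ∫ t in t₀..t₁, logDeriv (comparisonQuotient p W y₀) (ζ + t * μ)).im| ≤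
      2 * Real.pi * (2 * a * p.natDegree : ℕ) := by
  set r := comparisonQuotient p W y₀ with hr
  have hra : ∀ t ∈ Set.Icc t₀ t₁, AnalyticAt ℂ r (ζ + t * μ) := fun t ht =>
    (analyticAt_eval_specialize p analyticAt_id (hW t ht)).div
      (analyticAt_eval_specialize p analyticAt_id analyticAt_const) (hg t ht)
  have hr0 : ∀ t ∈ Set.Icc t₀ t₁, r (ζ + t * μ) ≠ 0 := fun t ht => div_ne_zero (hf t ht) (hg t ht)
  set φ : ℝ → ℂ := fun t => r (ζ + t * μ) with hφ
  set φ' : ℝ → ℂ := fun t => deriv r (ζ + t * μ) * μ with hφ'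
  have hγ : ∀ t : ℝ, HasDerivAt (fun t : ℝ => ζ + t * μ) μ t := by
    intro t
    have h2 : HasDerivAt (fun x : ℝ => (x : ℂ)) 1 t := ofRealCLM.hasDerivAt
    simpa using (h2.mul_const μ).const_add ζ
  have hd : ∀ t ∈ Set.Icc t₀ t₁, HasDerivAt φ (φ' t) t := fun t ht =>
    HasDerivAt.comp (h₂ := r) (h := fun t : ℝ => ζ + t * μ) t
      (hra t ht).differentiableAt.hasDerivAt (hγ t)
  have hcγ : Continuous fun t : ℝ => ζ + t * μ := by fun_prop
  have hc : ContinuousOn (fun t => φ' t / φ t) (Set.Icc t₀ t₁) := by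
    intro t ht
    refine ContinuousAt.continuousWithinAt ?_
    refine ContinuousAt.div ?_ ?_ (hr0 t ht)
    · exact (ContinuousAt.comp (f := fun t : ℝ => ζ + t * μ) (hra t ht).deriv.continuousAt
        hcγ.continuousAt).mul continuousAt_const
    · exact ContinuousAt.comp (f := fun t : ℝ => ζ + t * μ) (hra t ht).continuousAt
        hcγ.continuousAt
  have hexp := eq_mul_exp_integral h01 hd hr0 hc
  have hφ0 : φ t₀ = 1 := by
    rw [hφ, hr]
    simp only [comparisonQuotient]
    rw [hW0]
    exact div_self (hg t₀ ⟨le_rfl, h01⟩)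
  rw [hφ0] at hexp
  simp only [one_mul] at hexp
  set L : ℝ → ℂ := fun x => ∫ u in t₀..x, φ' u / φ u with hL
  have hLc : ContinuousOn L (Set.Icc t₀ t₁) :=
    (intervalIntegral.continuousOn_primitive_interval
      (by rw [Set.uIcc_of_le h01]; exact hc.integrableOn_Icc)).mono (by rw [Set.uIcc_of_le h01])
  have h00 : t₀ ∈ Set.Icc t₀ t₁ := ⟨le_rfl, h01⟩
  have hprops := edgePoly_props p ζ μ t₀ (hlc t₀ h00)
  have hmain := abs_arg_variation_le (edgePoly p ζ μ) a (natDegree_coeff_edgePoly_le p a ha ζ μ)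
    hres h01 (y := fun t => (W (ζ + t * μ)).re) (y₀ := y₀) (θ := fun t => (L t).im) ?_ ?_ ?_ ?_
    ?_ ?_ ?_ ?_
  · rw [hprops.1] at hmain
    have h1 : L t₀ = 0 := by simp [hL]
    have h2 : (μ * ∫ t in t₀..t₁, logDeriv r (ζ + t * μ)) = L t₁ := by
      rw [hL, ← intervalIntegral.integral_const_mul]
      refine intervalIntegral.integral_congr fun t _ => ?_
      simp only [hφ, hφ', logDeriv_apply]
      ring
    rw [h2]
    simpa [h1] using hmain
  · intro t ht
    rw [hprops.2]
    simpa only [eval_comp, eval_add, eval_mul, eval_C, eval_X] using hlc t ht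
  · intro t ht
    refine ContinuousAt.continuousWithinAt ?_
    exact Complex.continuous_re.continuousAt.comp
      (ContinuousAt.comp (f := fun t : ℝ => ζ + t * μ) (hW t ht).continuousAt hcγ.continuousAt)
  · simp [hW0]
  · simp [hW1]
  · intro t ht
    rw [specialize_edgePoly]
    exact hg t ht
  · intro t ht
    rw [specialize_edgePoly]
    have : (((W (ζ + t * μ)).re : ℝ) : ℂ) = W (ζ + t * μ) := Complex.ext rfl (by simp [hWr t ht])
    rw [this]
    exact hf t ht
  · exact Complex.continuous_im.comp_continuousOn hLc
  · intro t ht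
    rw [specialize_edgePoly]
    have h1 : (((W (ζ + t * μ)).re : ℝ) : ℂ) = W (ζ + t * μ) := Complex.ext rfl (by simp [hWr t ht])
    rw [h1]
    have h2 := hexp t ht
    change φ t = ‖φ t‖ * exp (((L t).im : ℝ) * I)
    rw [h2, Complex.norm_exp, Complex.ofReal_exp, ← Complex.exp_add]
    congr 1
    exact (Complex.re_add_im (L t)).symm

variable {a b c d : ℝ}

/-- The conditions on a bivariate polynomial `p` that are needed for bounding the order sum of
`p(z, W z) / p(z, y₀)` in a rectangle. -/
structure IsGenericOn (p : ℂ[X][X]) (W : ℂ → ℂ) (y₀ : ℝ) (a b c d : ℝ) : Prop where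
  leadingCoeff_ne : ∀ z ∈ rectBoundary a b c d, p.leadingCoeff.eval z ≠ 0
  bottom : conjResultant (edgePoly p (c * I) 1) ≠ 0
  top : conjResultant (edgePoly p (d * I) 1) ≠ 0
  right : conjResultant (edgePoly p b I) ≠ 0
  left : conjResultant (edgePoly p a I) ≠ 0
  eval_ne : ∀ z ∈ rectBoundary a b c d, (specialize p z).eval (W z) ≠ 0
  eval_ne' : ∀ z ∈ rectBoundary a b c d, (specialize p z).eval (y₀ : ℂ) ≠ 0

/-- A function that is real on the boundary of a rectangle and takes the same value at the four
corners. -/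
structure IsRealOnBoundary (W : ℂ → ℂ) (y₀ : ℝ) (a b c d : ℝ) : Prop where
  analyticAt : ∀ z ∈ rectBoundary a b c d, AnalyticAt ℂ W z
  im_eq : ∀ z ∈ rectBoundary a b c d, (W z).im = 0
  corner₁ : W (a + c * I) = y₀
  corner₂ : W (b + c * I) = y₀
  corner₃ : W (a + d * I) = y₀
  corner₄ : W (b + d * I) = y₀

theorem abs_im_rectIntegral_logDeriv_le (hab : a ≤ b) (hcd : c ≤ d) (p : ℂ[X][X]) (m : ℕ)
    (hm : ∀ k, (p.coeff k).natDegree ≤ m) {W : ℂ → ℂ} {y₀ : ℝ}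
    (hW : IsRealOnBoundary W y₀ a b c d) (hp : IsGenericOn p W y₀ a b c d) :
    |(rectIntegral (logDeriv (comparisonQuotient p W y₀)) a b c d).im| ≤
      2 * Real.pi * (8 * m * p.natDegree : ℕ) := by
  have mb : ∀ t ∈ Set.Icc a b, (c * I + t * 1 : ℂ) ∈ rectBoundary a b c d := fun t ht => by
    have := mem_rectBoundary_bottom hcd ht
    rwa [mul_one, add_comm]
  have mt : ∀ t ∈ Set.Icc a b, (d * I + t * 1 : ℂ) ∈ rectBoundary a b c d := fun t ht => by
    have := mem_rectBoundary_top hcd ht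
    rwa [mul_one, add_comm]
  have mr : ∀ t ∈ Set.Icc c d, (b + t * I : ℂ) ∈ rectBoundary a b c d := fun t ht =>
    mem_rectBoundary_right hab ht
  have ml : ∀ t ∈ Set.Icc c d, (a + t * I : ℂ) ∈ rectBoundary a b c d := fun t ht =>
    mem_rectBoundary_left hab ht
  have hb := abs_im_integral_logDeriv_le p m hm (c * I) 1 hab
    (fun t ht => hp.leadingCoeff_ne _ (mb t ht)) hp.bottom (fun t ht => hW.analyticAt _ (mb t ht))
    (fun t ht => hW.im_eq _ (mb t ht)) (by rw [mul_one, add_comm]; exact hW.corner₁)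
    (by rw [mul_one, add_comm]; exact hW.corner₂) (fun t ht => hp.eval_ne _ (mb t ht))
    (fun t ht => hp.eval_ne' _ (mb t ht))
  have ht := abs_im_integral_logDeriv_le p m hm (d * I) 1 hab
    (fun t ht => hp.leadingCoeff_ne _ (mt t ht)) hp.top (fun t ht => hW.analyticAt _ (mt t ht))
    (fun t ht => hW.im_eq _ (mt t ht)) (by rw [mul_one, add_comm]; exact hW.corner₃)
    (by rw [mul_one, add_comm]; exact hW.corner₄) (fun t ht => hp.eval_ne _ (mt t ht))
    (fun t ht => hp.eval_ne' _ (mt t ht))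
  have hr := abs_im_integral_logDeriv_le p m hm b I hcd
    (fun t ht => hp.leadingCoeff_ne _ (mr t ht)) hp.right (fun t ht => hW.analyticAt _ (mr t ht))
    (fun t ht => hW.im_eq _ (mr t ht)) hW.corner₂ hW.corner₄ (fun t ht => hp.eval_ne _ (mr t ht))
    (fun t ht => hp.eval_ne' _ (mr t ht))
  have hl := abs_im_integral_logDeriv_le p m hm a I hcd
    (fun t ht => hp.leadingCoeff_ne _ (ml t ht)) hp.left (fun t ht => hW.analyticAt _ (ml t ht))
    (fun t ht => hW.im_eq _ (ml t ht)) hW.corner₁ hW.corner₃ (fun t ht => hp.eval_ne _ (ml t ht))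
    (fun t ht => hp.eval_ne' _ (ml t ht))
  simp only [mul_one, one_mul, add_comm (_ * I : ℂ)] at hb ht
  simp only [add_comm (_ : ℂ) (_ * I)] at hb ht hr hl
  rw [rectIntegral]
  simp only [add_comm (_ : ℂ) (_ * I)]
  rw [sub_im, add_im, sub_im]
  -- Each of the four edges contributes at most 2 · m · `p.natDegree` turns.
  have e : (2 * Real.pi * (8 * m * p.natDegree : ℕ) : ℝ) =
      4 * (2 * Real.pi * (2 * m * p.natDegree : ℕ)) := by push_cast; ring
  rw [e]
  rw [abs_le] at hb ht hr hl ⊢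
  constructor <;> linarith [hb.1, hb.2, ht.1, ht.2, hr.1, hr.2, hl.1, hl.2]

end EdgeIntegral

/-! ### Perturbation to general position -/

section Perturbation

open Polynomial Filter Topology

/-- The bivariate polynomial `p(X - κ, Y - e)`. -/
noncomputable def shiftPoly (p : ℂ[X][X]) (κ e : ℂ) : ℂ[X][X] :=
  (p.map (compRingHom (X - C κ))).comp (X - C (C e))

theorem eval_specialize_shiftPoly (p : ℂ[X][X]) (κ e z y : ℂ) :
    (specialize (shiftPoly p κ e) z).eval y = (specialize p (z - κ)).eval (y - e) := by
  have h1 : ((p.map (compRingHom (X - C κ))).map (evalRingHom z)) = specialize p (z - κ) := by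
    rw [specialize, Polynomial.map_map]
    congr 1
    ext x <;> simp
  rw [shiftPoly, specialize, Polynomial.map_comp, h1, eval_comp]
  simp

theorem shiftPoly_props (p : ℂ[X][X]) (κ e : ℂ) :
    (shiftPoly p κ e).natDegree = p.natDegree ∧
      ∀ z, (shiftPoly p κ e).leadingCoeff.eval z = p.leadingCoeff.eval (z - κ) := by
  rcases eq_or_ne p 0 with rfl | hp
  · simp [shiftPoly]
  have h1 : (compRingHom (X - C κ)) p.leadingCoeff ≠ 0 := by
    rw [coe_compRingHom_apply, sub_eq_add_neg, ← C_neg, Ne, comp_X_add_C_eq_zero_iff]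
    exact leadingCoeff_ne_zero.2 hp
  refine ⟨?_, fun z => ?_⟩
  · rw [shiftPoly, natDegree_comp, natDegree_X_sub_C, mul_one,
      natDegree_map_of_leadingCoeff_ne_zero _ h1]
  · rw [shiftPoly, leadingCoeff_comp (by rw [natDegree_X_sub_C]; exact one_ne_zero),
      leadingCoeff_X_sub_C, one_pow, mul_one, leadingCoeff_map_of_leadingCoeff_ne_zero _ h1,
      coe_compRingHom_apply, eval_comp]
    simp

theorem natDegree_coeff_shiftPoly_le (p : ℂ[X][X]) (m : ℕ) (hm : ∀ k, (p.coeff k).natDegree ≤ m)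
    (κ e : ℂ) (n : ℕ) : ((shiftPoly p κ e).coeff n).natDegree ≤ m := by
  rw [shiftPoly, comp, eval₂_eq_sum_range, finsetSum_coeff]
  refine natDegree_sum_le_of_forall_le _ _ fun k _ => ?_
  have h1 : (X - C (C e) : ℂ[X][X]) ^ k = ((X - C e) ^ k).map C := by
    rw [Polynomial.map_pow, Polynomial.map_sub, map_X, map_C]
  rw [coeff_C_mul, h1, coeff_map, coeff_map, coe_compRingHom_apply]
  refine natDegree_mul_le.trans ?_
  rw [natDegree_C, add_zero]
  refine natDegree_comp_le.trans ?_
  rw [natDegree_X_sub_C, mul_one]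
  exact hm k

/-- A root y shared by q and its conjugate makes both y and conj y roots of q. -/
theorem isCoprime_map_conj {q : ℂ[X]} (h : ∀ y, q.eval y = 0 → q.eval (starRingEnd ℂ y) ≠ 0) :
    IsCoprime q (q.map (starRingEnd ℂ)) := by
  rw [Polynomial.isCoprime_iff_aeval_ne_zero_of_isAlgClosed ℂ ℂ]
  intro y
  by_contra hcon
  push Not at hcon
  obtain ⟨h1, h2⟩ := hcon
  rw [coe_aeval_eq_eval] at h1 h2
  refine h y h1 ?_
  have h3 : (q.map (starRingEnd ℂ)).eval y = starRingEnd ℂ (q.eval (starRingEnd ℂ y)) := by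
    rw [eval_map, eval, hom_eval₂, RingHom.comp_id, starRingEnd_self_apply]
  rw [h3] at h2
  simpa using h2

/-- It suffices to make the resultant nonzero at the single point t₀. There the roots are ρ + e, and
two of them can be conjugate to each other only if Im(ρ + e) = -Im(ρ' + e), which fixes the
imaginary part of e. -/
theorem conjResultant_edgePoly_shiftPoly_ne_zero (p : ℂ[X][X]) (κ ζ μ : ℂ) (t₀ : ℝ)
    (hlc : p.leadingCoeff.eval (ζ + t₀ * μ - κ) ≠ 0) (e : ℂ)
    (he : ∀ ρ ∈ (specialize p (ζ + t₀ * μ - κ)).roots,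
      ∀ ρ' ∈ (specialize p (ζ + t₀ * μ - κ)).roots, e.im ≠ (-ρ.im - ρ'.im) / 2) :
    conjResultant (edgePoly (shiftPoly p κ e) ζ μ) ≠ 0 := by
  intro h0
  obtain ⟨-, hs2⟩ := shiftPoly_props p κ e
  have hlc' : (shiftPoly p κ e).leadingCoeff.eval (ζ + t₀ * μ) ≠ 0 := by rwa [hs2]
  obtain ⟨-, he2⟩ := edgePoly_props (shiftPoly p κ e) ζ μ t₀ hlc'
  have hlc'' : (edgePoly (shiftPoly p κ e) ζ μ).leadingCoeff.eval (t₀ : ℂ) ≠ 0 := by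
    rw [he2]
    simpa only [eval_comp, eval_add, eval_mul, eval_C, eval_X] using hlc'
  have h1 := eval_conjResultant _ t₀ hlc''
  rw [h0, eval_zero] at h1
  refine resultant_ne_zero _ _ (isCoprime_map_conj fun y hy hy' => ?_) h1.symm
  rw [specialize_edgePoly, eval_specialize_shiftPoly] at hy hy'
  have hne := specialize_ne_zero p _ hlc
  refine he _ ((mem_roots hne).2 hy) _ ((mem_roots hne).2 hy') ?_
  simp
  ring

/-- The order of choice matters. The imaginary part e₂ is taken first, to make the resultant
nonzero; then real roots occur at only finitely many t, and the real part e₁ has finitely many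
values to avoid. -/
theorem exists_finite_exceptional (p : ℂ[X][X]) (κ ζ μ : ℂ) {t₀ t₁ : ℝ} (h01 : t₀ ≤ t₁)
    (hlc : ∀ t ∈ Set.Icc t₀ t₁, p.leadingCoeff.eval (ζ + t * μ - κ) ≠ 0) (y : ℝ → ℝ) (y₀ : ℝ) :
    ∃ F : Set ℝ, F.Finite ∧ ∀ e₂ ∉ F, ∃ F' : Set ℝ, F'.Finite ∧ ∀ e₁ ∉ F',
      conjResultant (edgePoly (shiftPoly p κ (e₁ + e₂ * I)) ζ μ) ≠ 0 ∧
      ∀ t ∈ Set.Icc t₀ t₁,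
        (specialize (shiftPoly p κ (e₁ + e₂ * I)) (ζ + t * μ)).eval (y t : ℂ) ≠ 0 ∧
        (specialize (shiftPoly p κ (e₁ + e₂ * I)) (ζ + t * μ)).eval (y₀ : ℂ) ≠ 0 := by
  classical
  set R := (specialize p (ζ + t₀ * μ - κ)).roots with hR
  refine ⟨Set.image2 (fun ρ ρ' : ℂ => (-ρ.im - ρ'.im) / 2) {ρ | ρ ∈ R} {ρ | ρ ∈ R},
    Set.Finite.image2 _ (R.finite_toSet) (R.finite_toSet), fun e₂ he₂ => ?_⟩
  have hres : ∀ e₁ : ℝ, conjResultant (edgePoly (shiftPoly p κ (e₁ + e₂ * I)) ζ μ) ≠ 0 := by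
    intro e₁
    refine conjResultant_edgePoly_shiftPoly_ne_zero p κ ζ μ t₀ (hlc t₀ ⟨le_rfl, h01⟩) _ ?_
    intro ρ hρ ρ' hρ' heq
    exact he₂ ⟨ρ, hρ, ρ', hρ', by simpa using heq.symm⟩
  -- A real shift e₁ translates roots along the real direction, so the parameters `t` with a real
  -- root can be read off at e₁ = 0.
  set Q := edgePoly (shiftPoly p κ ((0 : ℝ) + e₂ * I)) ζ μ with hQ
  have hQlc : ∀ t ∈ Set.Icc t₀ t₁, Q.leadingCoeff.eval (t : ℂ) ≠ 0 := by
    intro t ht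
    have h1 : (shiftPoly p κ ((0 : ℝ) + e₂ * I)).leadingCoeff.eval (ζ + t * μ) ≠ 0 := by
      rw [(shiftPoly_props _ _ _).2]
      exact hlc t ht
    rw [hQ, (edgePoly_props _ ζ μ t h1).2]
    simpa only [eval_comp, eval_add, eval_mul, eval_C, eval_X] using h1
  have hT := finite_realRootCount_ne_zero Q (hres 0)
  set T := {t : ℝ | Q.leadingCoeff.eval (t : ℂ) ≠ 0 ∧ realRootCount Q t ≠ 0} with hTdef
  refine ⟨⋃ t ∈ T, ⋃ ρ ∈ {ρ | ρ ∈ (specialize Q t).roots}, {y t - ρ.re, y₀ - ρ.re},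
    hT.biUnion fun t _ => (Multiset.finite_toSet _).biUnion fun ρ _ => Set.toFinite _,
    fun e₁ he₁ => ⟨hres e₁, fun t ht => ?_⟩⟩
  have key : ∀ x : ℝ, (specialize (shiftPoly p κ (e₁ + e₂ * I)) (ζ + t * μ)).eval (x : ℂ) = 0 →
      t ∈ T ∧ ((x - e₁ : ℝ) : ℂ) ∈ (specialize Q t).roots := by
    intro x hx
    have h1 : ((x - e₁ : ℝ) : ℂ) ∈ (specialize Q t).roots := by
      rw [mem_roots (specialize_ne_zero Q t (hQlc t ht)), IsRoot.def, hQ, specialize_edgePoly,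
        eval_specialize_shiftPoly]
      rw [eval_specialize_shiftPoly] at hx
      rw [← hx]
      congr 1
      push_cast
      ring
    refine ⟨⟨hQlc t ht, ?_⟩, h1⟩
    rw [realRootCount, Ne, Multiset.card_eq_zero]
    intro h2
    have h3 : ((x - e₁ : ℝ) : ℂ) ∈ (specialize Q t).roots.filter (fun z => z.im = 0) :=
      Multiset.mem_filter.2 ⟨h1, Complex.ofReal_im _⟩
    rw [h2] at h3
    exact Multiset.notMem_zero _ h3
  constructor
  · intro hx
    obtain ⟨h1, h2⟩ := key _ hx
    apply he₁
    simp only [Set.mem_iUnion]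
    refine ⟨t, h1, _, h2, ?_⟩
    left
    simp
  · intro hx
    obtain ⟨h1, h2⟩ := key _ hx
    apply he₁
    simp only [Set.mem_iUnion]
    refine ⟨t, h1, _, h2, ?_⟩
    right
    simp

theorem exists_Ioo_notMem_of_finite {F : Set ℝ} (hF : F.Finite) {ε : ℝ} (hε : 0 < ε) :
    ∃ x ∈ Set.Ioo 0 ε, x ∉ F :=
  ((Set.Ioo_infinite hε).sdiff hF).nonempty.imp fun _ hx => ⟨hx.1, hx.2⟩

variable {a b c d : ℝ}

/-- The two coordinates of κ are chosen separately: one keeps the shifted roots off the vertical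
sides, the other off the horizontal ones. -/
theorem exists_shift_leadingCoeff_ne_zero (p : ℂ[X]) (hp : p ≠ 0) {ε : ℝ} (hε : 0 < ε) :
    ∃ κ : ℂ, ‖κ‖ < ε ∧ ∀ z ∈ rectBoundary a b c d, p.eval (z - κ) ≠ 0 := by
  have hfin : {ρ | ρ ∈ p.roots}.Finite := Multiset.finite_toSet _
  obtain ⟨x, hx, hxF⟩ := exists_Ioo_notMem_of_finite
    ((hfin.image fun ρ => a - ρ.re).union (hfin.image fun ρ => b - ρ.re)) (half_pos hε)
  obtain ⟨y, hy, hyF⟩ := exists_Ioo_notMem_of_finite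
    ((hfin.image fun ρ => c - ρ.im).union (hfin.image fun ρ => d - ρ.im)) (half_pos hε)
  refine ⟨x + y * I, ?_, fun z hz h0 => ?_⟩
  · refine (norm_add_le _ _).trans_lt ?_
    rw [norm_mul, norm_I, mul_one, norm_real, norm_real, Real.norm_of_nonneg hx.1.le,
      Real.norm_of_nonneg hy.1.le]
    linarith [hx.2, hy.2]
  · have hroot : z - (x + y * I) ∈ {ρ | ρ ∈ p.roots} := (mem_roots hp).2 h0
    rw [Set.mem_union, not_or] at hxF hyF
    rcases (rectBoundary_cases hz).1 with h | h | h | h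
    · exact hxF.1 ⟨_, hroot, by simp [h]⟩
    · exact hxF.2 ⟨_, hroot, by simp [h]⟩
    · exact hyF.1 ⟨_, hroot, by simp [h]⟩
    · exact hyF.2 ⟨_, hroot, by simp [h]⟩

theorem exists_isGenericOn_shiftPoly (hab : a ≤ b) (hcd : c ≤ d) (p : ℂ[X][X]) (hp : p ≠ 0)
    {W : ℂ → ℂ} {y₀ : ℝ} (hW : IsRealOnBoundary W y₀ a b c d) {ε : ℝ} (hε : 0 < ε) :
    ∃ κ e : ℂ, ‖κ‖ < ε ∧ ‖e‖ < ε ∧ IsGenericOn (shiftPoly p κ e) W y₀ a b c d := by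
  obtain ⟨κ, hκ, hlc⟩ := exists_shift_leadingCoeff_ne_zero (a := a) (b := b) (c := c) (d := d)
    p.leadingCoeff (leadingCoeff_ne_zero.2 hp) hε
  have mb : ∀ t ∈ Set.Icc a b, (c * I + t * 1 : ℂ) ∈ rectBoundary a b c d := fun t ht => by
    have := mem_rectBoundary_bottom hcd ht
    rwa [mul_one, add_comm]
  have mt : ∀ t ∈ Set.Icc a b, (d * I + t * 1 : ℂ) ∈ rectBoundary a b c d := fun t ht => by
    have := mem_rectBoundary_top hcd ht
    rwa [mul_one, add_comm]
  have mr : ∀ t ∈ Set.Icc c d, (b + t * I : ℂ) ∈ rectBoundary a b c d := fun t ht =>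
    mem_rectBoundary_right hab ht
  have ml : ∀ t ∈ Set.Icc c d, (a + t * I : ℂ) ∈ rectBoundary a b c d := fun t ht =>
    mem_rectBoundary_left hab ht
  obtain ⟨F₁, hF₁, h₁⟩ := exists_finite_exceptional p κ (c * I) 1 hab
    (fun t ht => hlc _ (mb t ht)) (fun t => (W (c * I + t * 1)).re) y₀
  obtain ⟨F₂, hF₂, h₂⟩ := exists_finite_exceptional p κ (d * I) 1 hab
    (fun t ht => hlc _ (mt t ht)) (fun t => (W (d * I + t * 1)).re) y₀
  obtain ⟨F₃, hF₃, h₃⟩ := exists_finite_exceptional p κ b I hcd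
    (fun t ht => hlc _ (mr t ht)) (fun t => (W (b + t * I)).re) y₀
  obtain ⟨F₄, hF₄, h₄⟩ := exists_finite_exceptional p κ a I hcd
    (fun t ht => hlc _ (ml t ht)) (fun t => (W (a + t * I)).re) y₀
  obtain ⟨e₂, he₂, hn₂⟩ := exists_Ioo_notMem_of_finite ((hF₁.union hF₂).union (hF₃.union hF₄))
    (half_pos hε)
  simp only [Set.mem_union, not_or] at hn₂
  obtain ⟨G₁, hG₁, g₁⟩ := h₁ e₂ hn₂.1.1
  obtain ⟨G₂, hG₂, g₂⟩ := h₂ e₂ hn₂.1.2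
  obtain ⟨G₃, hG₃, g₃⟩ := h₃ e₂ hn₂.2.1
  obtain ⟨G₄, hG₄, g₄⟩ := h₄ e₂ hn₂.2.2
  obtain ⟨e₁, he₁, hn₁⟩ := exists_Ioo_notMem_of_finite ((hG₁.union hG₂).union (hG₃.union hG₄))
    (half_pos hε)
  simp only [Set.mem_union, not_or] at hn₁
  obtain ⟨r₁, k₁⟩ := g₁ e₁ hn₁.1.1
  obtain ⟨r₂, k₂⟩ := g₂ e₁ hn₁.1.2
  obtain ⟨r₃, k₃⟩ := g₃ e₁ hn₁.2.1
  obtain ⟨r₄, k₄⟩ := g₄ e₁ hn₁.2.2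
  set s := shiftPoly p κ (e₁ + e₂ * I) with hs
  have hall : ∀ z ∈ rectBoundary a b c d,
      (specialize s z).eval (W z) ≠ 0 ∧ (specialize s z).eval (y₀ : ℂ) ≠ 0 := by
    intro z hz
    have hre : (((W z).re : ℝ) : ℂ) = W z := Complex.ext rfl (by simp [hW.im_eq z hz])
    obtain ⟨hcase, hzre, hzim⟩ := rectBoundary_cases hz
    rw [← hre]
    rcases hcase with h | h | h | h
    · have hz' : (a + z.im * I : ℂ) = z := by rw [← h]; exact re_add_im z
      have := k₄ z.im hzim
      rwa [hz'] at this
    · have hz' : (b + z.im * I : ℂ) = z := by rw [← h]; exact re_add_im z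
      have := k₃ z.im hzim
      rwa [hz'] at this
    · have hz' : (c * I + z.re * 1 : ℂ) = z := by rw [← h, mul_one, add_comm]; exact re_add_im z
      have := k₁ z.re hzre
      rwa [hz'] at this
    · have hz' : (d * I + z.re * 1 : ℂ) = z := by rw [← h, mul_one, add_comm]; exact re_add_im z
      have := k₂ z.re hzre
      rwa [hz'] at this
  refine ⟨κ, e₁ + e₂ * I, hκ, ?_, ?_, r₁, r₂, r₃, r₄, fun z hz => (hall z hz).1,
    fun z hz => (hall z hz).2⟩
  · refine (norm_add_le _ _).trans_lt ?_
    rw [norm_mul, norm_I, mul_one, norm_real, norm_real, Real.norm_of_nonneg he₁.1.le,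
      Real.norm_of_nonneg he₂.1.le]
    linarith [he₁.2, he₂.2]
  · intro z hz
    rw [(shiftPoly_props _ _ _).2]
    exact hlc z hz

end Perturbation

/-! ### Orders of meromorphic functions and of z ↦ p(z, W z) -/

section OrderSum

open Polynomial Filter Topology

theorem Meromorphic.meromorphicOrderAt_ne_top {f : ℂ → ℂ} (hf : Meromorphic f) {z₀ : ℂ}
    (h : AnalyticAt ℂ f z₀) (h0 : f z₀ ≠ 0) (z : ℂ) : meromorphicOrderAt f z ≠ ⊤ := by
  refine MeromorphicOn.meromorphicOrderAt_ne_top_of_isPreconnected (U := Set.univ) (x := z₀)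
    (fun x _ => hf x) isPreconnected_univ (Set.mem_univ _) (Set.mem_univ _) ?_
  rw [h.meromorphicOrderAt_eq, h.analyticOrderAt_eq_zero.2 h0]
  simp

theorem Meromorphic.finite_meromorphicOrderAt_ne_zero {f : ℂ → ℂ} (hf : Meromorphic f)
    (htop : ∀ z, meromorphicOrderAt f z ≠ ⊤) {K : Set ℂ} (hK : IsCompact K) :
    {z | z ∈ K ∧ meromorphicOrderAt f z ≠ 0}.Finite := by
  refine ((MeromorphicOn.divisor f K).finiteSupport hK).subset fun z hz => ?_
  rw [Function.mem_support, MeromorphicOn.divisor_apply (fun x _ => hf x) hz.1]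
  intro h0
  rcases WithTop.untop₀_eq_zero.1 h0 with h | h
  · exact hz.2 h
  · exact htop z h

theorem AnalyticAt.meromorphicOrderAt_eq_zero {f : ℂ → ℂ} {z : ℂ} (h : AnalyticAt ℂ f z)
    (h0 : f z ≠ 0) : meromorphicOrderAt f z = 0 := by
  rw [h.meromorphicOrderAt_eq, h.analyticOrderAt_eq_zero.2 h0]
  simp

theorem le_meromorphicOrderAt_finsetSum {ι : Type*} (s : Finset ι) {F : ι → ℂ → ℂ} {z : ℂ}
    {c : WithTop ℤ} (hF : ∀ i ∈ s, MeromorphicAt (F i) z)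
    (hc : ∀ i ∈ s, c ≤ meromorphicOrderAt (F i) z) :
    MeromorphicAt (fun w => ∑ i ∈ s, F i w) z ∧
      c ≤ meromorphicOrderAt (fun w => ∑ i ∈ s, F i w) z := by
  classical
  induction s using Finset.induction_on with
  | empty =>
    refine ⟨by simp, ?_⟩
    simp [meromorphicOrderAt_const]
  | insert i s hi ih =>
    obtain ⟨h1, h2⟩ := ih (fun j hj => hF j (Finset.mem_insert_of_mem hj))
      (fun j hj => hc j (Finset.mem_insert_of_mem hj))
    have h3 := hF i (Finset.mem_insert_self _ _)
    simp only [Finset.sum_insert hi]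
    exact ⟨h3.add h1, (le_min (hc i (Finset.mem_insert_self _ _)) h2).trans
      (meromorphicOrderAt_add h3 h1)⟩

theorem analyticAt_polynomial_eval (q : ℂ[X]) (z : ℂ) : AnalyticAt ℂ (fun w => q.eval w) z :=
  AnalyticAt.aeval_polynomial (f := fun w => w) (by fun_prop) q |>.congr
    (Eventually.of_forall fun w => by simp)

theorem meromorphicOrderAt_polynomial_eval {q : ℂ[X]} (hq : q ≠ 0) (z : ℂ) :
    meromorphicOrderAt (fun w => q.eval w) z = (q.rootMultiplicity z : ℤ) := by
  rw [meromorphicOrderAt_eq_int_iff (analyticAt_polynomial_eval q z).meromorphicAt]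
  obtain ⟨r, hr, hr0⟩ := exists_eq_pow_rootMultiplicity_mul_and_not_dvd q hq z
  refine ⟨fun w => r.eval w, analyticAt_polynomial_eval r z, fun h => hr0 (dvd_iff_isRoot.2 h),
    Eventually.of_forall fun w => ?_⟩
  conv_lhs => rw [hr]
  simp

theorem sum_untop₀_meromorphicOrderAt_polynomial_le {q : ℂ[X]} (hq : q ≠ 0) (A : Finset ℂ) :
    ∑ z ∈ A, (meromorphicOrderAt (fun w => q.eval w) z).untop₀ ≤ (q.natDegree : ℤ) := by
  classical
  simp only [meromorphicOrderAt_polynomial_eval hq]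
  have h1 : ∑ z ∈ A, q.rootMultiplicity z ≤ q.natDegree := by
    calc ∑ z ∈ A, q.rootMultiplicity z = ∑ z ∈ A, q.roots.count z := by simp
      _ ≤ Multiset.card q.roots := by
        calc ∑ z ∈ A, q.roots.count z
          _ ≤ ∑ z ∈ A ∪ q.roots.toFinset, q.roots.count z :=
            Finset.sum_le_sum_of_subset Finset.subset_union_left
          _ = _ := Multiset.sum_count_eq_card fun z hz =>
            Finset.mem_union_right _ (Multiset.mem_toFinset.2 hz)
      _ ≤ q.natDegree := card_roots' q
  calc _ = ((∑ z ∈ A, q.rootMultiplicity z : ℕ) : ℤ) := by push_cast; rfl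
    _ ≤ _ := by exact_mod_cast h1

theorem eval_eval_C (p : ℂ[X][X]) (z y : ℂ) :
    (p.eval (C y)).eval z = (specialize p z).eval y := by
  have h := hom_eval₂ p (RingHom.id ℂ[X]) (evalRingHom z) (C y)
  rw [RingHom.comp_id, coe_evalRingHom, eval_C] at h
  rw [specialize, eval_map]
  exact h

theorem natDegree_eval_C_le (p : ℂ[X][X]) (m : ℕ) (hm : ∀ k, (p.coeff k).natDegree ≤ m) (y : ℂ) :
    (p.eval (C y)).natDegree ≤ m := by
  rw [eval_eq_sum_range]
  refine natDegree_sum_le_of_forall_le _ _ fun k _ => ?_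
  rw [← C_pow]
  exact (natDegree_mul_C_le _ _).trans (hm k)

/-- The function `z ↦ p(z, W z)`. -/
noncomputable def evalAlong (p : ℂ[X][X]) (W : ℂ → ℂ) (z : ℂ) : ℂ := (specialize p z).eval (W z)

theorem evalAlong_eq_sum (p : ℂ[X][X]) (W : ℂ → ℂ) :
    evalAlong p W = fun z => ∑ k ∈ Finset.range (p.natDegree + 1),
      (p.coeff k).eval z * W z ^ k := by
  ext z
  rw [evalAlong, specialize, eval_map, eval₂_eq_sum_range]
  rfl

theorem meromorphic_evalAlong (p : ℂ[X][X]) {W : ℂ → ℂ} (hW : Meromorphic W) :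
    Meromorphic (evalAlong p W) := by
  intro z
  rw [evalAlong_eq_sum]
  refine MeromorphicAt.fun_sum fun k _ => ?_
  exact (analyticAt_polynomial_eval _ z).meromorphicAt.mul ((hW z).pow k)

theorem analyticAt_evalAlong (p : ℂ[X][X]) {W : ℂ → ℂ} {z : ℂ} (hW : AnalyticAt ℂ W z) :
    AnalyticAt ℂ (evalAlong p W) z :=
  analyticAt_eval_specialize p analyticAt_id hW

theorem le_meromorphicOrderAt_evalAlong (p : ℂ[X][X]) {W : ℂ → ℂ} {z : ℂ}
    (hW : MeromorphicAt W z) {n : ℕ} (h : ((-n : ℤ) : WithTop ℤ) ≤ meromorphicOrderAt W z) :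
    ((-(n * p.natDegree : ℕ) : ℤ) : WithTop ℤ) ≤ meromorphicOrderAt (evalAlong p W) z := by
  rw [evalAlong_eq_sum]
  refine (le_meromorphicOrderAt_finsetSum _ (fun k _ => ?_) fun k hk => ?_).2
  · exact (analyticAt_polynomial_eval _ z).meromorphicAt.mul (hW.pow k)
  have hk' : k ≤ p.natDegree := Nat.lt_succ_iff.1 (Finset.mem_range.1 hk)
  have h1 : ((-(n * p.natDegree : ℕ) : ℤ) : WithTop ℤ) ≤ meromorphicOrderAt (fun w => W w ^ k) z := by
    rw [fun_meromorphicOrderAt_pow hW]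
    rcases eq_or_ne k 0 with rfl | hk0
    · rw [Nat.cast_zero, zero_mul]
      exact WithTop.coe_le_coe.2 (neg_nonpos.2 (Int.natCast_nonneg _))
    cases hord : meromorphicOrderAt W z with
    | top => rw [WithTop.mul_top (by exact_mod_cast hk0)]; exact le_top
    | coe m =>
      rw [hord] at h
      have h' : (-n : ℤ) ≤ m := by exact_mod_cast h
      have : (-(n * p.natDegree : ℕ) : ℤ) ≤ k * m := by
        have h2 : (n * k : ℤ) ≤ n * p.natDegree := by exact_mod_cast Nat.mul_le_mul_left n hk'
        push_cast
        nlinarith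
      exact_mod_cast this
  have h2 := (analyticAt_polynomial_eval (p.coeff k) z).meromorphicOrderAt_nonneg
  have h3 := fun_meromorphicOrderAt_mul (analyticAt_polynomial_eval (p.coeff k) z).meromorphicAt
    (hW.fun_pow k)
  rw [h3]
  calc _ = 0 + ((-(n * p.natDegree : ℕ) : ℤ) : WithTop ℤ) := (zero_add _).symm
    _ ≤ _ := add_le_add h2 h1

variable {a b c d : ℝ}

theorem rectIntegral_deriv_eq_zero (hab : a ≤ b) (hcd : c ≤ d) {G : ℂ → ℂ}
    (hG : ∀ z ∈ rectBoundary a b c d, AnalyticAt ℂ G z) :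
    rectIntegral (deriv G) a b c d = 0 := by
  have key : ∀ (ζ μ : ℂ) (s t : ℝ), s ≤ t →
      (∀ x ∈ Set.Icc s t, (ζ + x * μ) ∈ rectBoundary a b c d) →
      μ * ∫ x in s..t, deriv G (ζ + x * μ) = G (ζ + t * μ) - G (ζ + s * μ) := by
    intro ζ μ s t hst hmem
    rw [← intervalIntegral.integral_const_mul]
    have hγ : ∀ x : ℝ, HasDerivAt (fun x : ℝ => ζ + x * μ) μ x := by
      intro x
      have h2 : HasDerivAt (fun x : ℝ => (x : ℂ)) 1 x := ofRealCLM.hasDerivAt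
      simpa using (h2.mul_const μ).const_add ζ
    have hcγ : Continuous fun t : ℝ => ζ + t * μ := by fun_prop
    refine intervalIntegral.integral_eq_sub_of_hasDerivAt
      (f := fun x : ℝ => G (ζ + x * μ)) (fun x hx => ?_) (ContinuousOn.intervalIntegrable ?_)
    · rw [Set.uIcc_of_le hst] at hx
      rw [mul_comm]
      exact HasDerivAt.comp (h₂ := G) (h := fun t : ℝ => ζ + t * μ) x
        (hG _ (hmem x hx)).differentiableAt.hasDerivAt (hγ x)
    · rw [Set.uIcc_of_le hst]
      intro x hx
      refine ContinuousAt.continuousWithinAt (continuousAt_const.mul ?_)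
      exact ContinuousAt.comp (f := fun t : ℝ => ζ + t * μ) (hG _ (hmem x hx)).deriv.continuousAt
        hcγ.continuousAt
  have e1 := key (c * I) 1 a b hab fun x hx => by
    have := mem_rectBoundary_bottom hcd hx
    rwa [mul_one, add_comm]
  have e2 := key (d * I) 1 a b hab fun x hx => by
    have := mem_rectBoundary_top hcd hx
    rwa [mul_one, add_comm]
  have e3 := key b I c d hcd fun x hx => mem_rectBoundary_right hab hx
  have e4 := key a I c d hcd fun x hx => mem_rectBoundary_left hab hx
  simp only [mul_one, one_mul, add_comm (_ * I : ℂ)] at e1 e2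
  rw [rectIntegral]
  simp only [add_comm (_ : ℂ) (_ * I)] at e1 e2 e3 e4 ⊢
  rw [e1, e2, e3, e4]
  ring

/-- On the slit plane log h is a single-valued primitive of the logarithmic derivative. -/
theorem rectIntegral_logDeriv_eq_zero (hab : a ≤ b) (hcd : c ≤ d) {h : ℂ → ℂ}
    (ha : ∀ z ∈ rectBoundary a b c d, AnalyticAt ℂ h z)
    (hs : ∀ z ∈ rectBoundary a b c d, h z ∈ slitPlane) :
    rectIntegral (logDeriv h) a b c d = 0 := by
  rw [← rectIntegral_deriv_eq_zero hab hcd (G := fun z => log (h z)) fun z hz =>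
    (ha z hz).clog (hs z hz)]
  refine rectIntegral_congr hab hcd fun z hz => ?_
  rw [((ha z hz).differentiableAt.hasDerivAt.clog (hs z hz)).deriv, logDeriv_apply]

end OrderSum

/-! ### Counting zeros in a rectangle -/

section RectangleCount

open Polynomial Filter Topology

variable {a b c d : ℝ}

theorem mem_Icc_of_mem_Ioo_reProdIm {z : ℂ} (hz : z ∈ (Set.Ioo a b ×ℂ Set.Ioo c d : Set ℂ)) :
    z ∈ (Set.Icc a b ×ℂ Set.Icc c d : Set ℂ) :=
  ⟨Set.Ioo_subset_Icc_self hz.1, Set.Ioo_subset_Icc_self hz.2⟩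

theorem untop₀_meromorphicOrderAt_div {f g : ℂ → ℂ} {z : ℂ} (hf : MeromorphicAt f z)
    (hg : MeromorphicAt g z) (hf' : meromorphicOrderAt f z ≠ ⊤) (hg' : meromorphicOrderAt g z ≠ ⊤) :
    (meromorphicOrderAt (f / g) z).untop₀ =
      (meromorphicOrderAt f z).untop₀ - (meromorphicOrderAt g z).untop₀ := by
  rw [meromorphicOrderAt_div hf hg]
  lift meromorphicOrderAt f z to ℤ using hf' with i
  lift meromorphicOrderAt g z to ℤ using hg' with j
  rw [← WithTop.LinearOrderedAddCommGroup.coe_sub]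
  simp only [WithTop.untop₀_coe]

theorem meromorphicOrderAt_div_ne_top {f g : ℂ → ℂ} {z : ℂ} (hf : MeromorphicAt f z)
    (hg : MeromorphicAt g z) (hf' : meromorphicOrderAt f z ≠ ⊤) (hg' : meromorphicOrderAt g z ≠ ⊤) :
    meromorphicOrderAt (f / g) z ≠ ⊤ := by
  rw [meromorphicOrderAt_div hf hg]
  lift meromorphicOrderAt f z to ℤ using hf' with i
  lift meromorphicOrderAt g z to ℤ using hg' with j
  rw [← WithTop.LinearOrderedAddCommGroup.coe_sub]
  exact WithTop.coe_ne_top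

/-- The argument principle for a quotient, with the order sum taken over any finite set that
contains the zeros and poles of the numerator and the denominator. -/
theorem rectIntegral_logDeriv_div (hab : a ≤ b) (hcd : c ≤ d) {f g : ℂ → ℂ} (hf : Meromorphic f)
    (hg : Meromorphic g) (hft : ∀ z, meromorphicOrderAt f z ≠ ⊤)
    (hgt : ∀ z, meromorphicOrderAt g z ≠ ⊤)
    (hfB : ∀ z ∈ rectBoundary a b c d, AnalyticAt ℂ f z ∧ f z ≠ 0)
    (hgB : ∀ z ∈ rectBoundary a b c d, AnalyticAt ℂ g z ∧ g z ≠ 0)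
    (A : Finset ℂ) (hA : ∀ z ∈ A, z ∈ (Set.Ioo a b ×ℂ Set.Ioo c d : Set ℂ))
    (hAf : ∀ z ∈ (Set.Ioo a b ×ℂ Set.Ioo c d : Set ℂ), meromorphicOrderAt f z ≠ 0 → z ∈ A)
    (hAg : ∀ z ∈ (Set.Ioo a b ×ℂ Set.Ioo c d : Set ℂ), meromorphicOrderAt g z ≠ 0 → z ∈ A) :
    rectIntegral (logDeriv (f / g)) a b c d =
      2 * Real.pi * I * (∑ z ∈ A, (meromorphicOrderAt f z).untop₀ -
        ∑ z ∈ A, (meromorphicOrderAt g z).untop₀ : ℤ) := by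
  rw [rectIntegral_logDeriv hab hcd (hf.div hg)
    (fun z => meromorphicOrderAt_div_ne_top (hf z) (hg z) (hft z) (hgt z))
    (fun z hz => ⟨(hfB z hz).1.div (hgB z hz).1 (hgB z hz).2,
      div_ne_zero (hfB z hz).2 (hgB z hz).2⟩) A hA]
  · rw [← Finset.sum_sub_distrib]
    congr 2
    exact Finset.sum_congr rfl fun z _ =>
      untop₀_meromorphicOrderAt_div (hf z) (hg z) (hft z) (hgt z)
  · intro z hz h
    by_contra hzA
    apply h
    rw [meromorphicOrderAt_div (hf z) (hg z), not_not.1 (mt (hAf z hz) hzA),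
      not_not.1 (mt (hAg z hz) hzA)]
    rfl

/-- A form of Rouché's theorem: a quotient with values in the slit plane does not wind around 0. -/
theorem sum_untop₀_eq_of_div_mem_slitPlane (hab : a ≤ b) (hcd : c ≤ d) {f g : ℂ → ℂ}
    (hf : Meromorphic f) (hg : Meromorphic g) (hft : ∀ z, meromorphicOrderAt f z ≠ ⊤)
    (hgt : ∀ z, meromorphicOrderAt g z ≠ ⊤)
    (hfB : ∀ z ∈ rectBoundary a b c d, AnalyticAt ℂ f z)
    (hgB : ∀ z ∈ rectBoundary a b c d, AnalyticAt ℂ g z)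
    (hs : ∀ z ∈ rectBoundary a b c d, f z / g z ∈ slitPlane)
    (A : Finset ℂ) (hA : ∀ z ∈ A, z ∈ (Set.Ioo a b ×ℂ Set.Ioo c d : Set ℂ))
    (hAf : ∀ z ∈ (Set.Ioo a b ×ℂ Set.Ioo c d : Set ℂ), meromorphicOrderAt f z ≠ 0 → z ∈ A)
    (hAg : ∀ z ∈ (Set.Ioo a b ×ℂ Set.Ioo c d : Set ℂ), meromorphicOrderAt g z ≠ 0 → z ∈ A) :
    ∑ z ∈ A, (meromorphicOrderAt f z).untop₀ = ∑ z ∈ A, (meromorphicOrderAt g z).untop₀ := by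
  have hf0 : ∀ z ∈ rectBoundary a b c d, f z ≠ 0 := fun z hz h0 => by
    have := hs z hz
    rw [h0, zero_div] at this
    exact zero_notMem_slitPlane this
  have hg0 : ∀ z ∈ rectBoundary a b c d, g z ≠ 0 := fun z hz h0 => by
    have := hs z hz
    rw [h0, div_zero] at this
    exact zero_notMem_slitPlane this
  have h1 := rectIntegral_logDeriv_div hab hcd hf hg hft hgt (fun z hz => ⟨hfB z hz, hf0 z hz⟩)
    (fun z hz => ⟨hgB z hz, hg0 z hz⟩) A hA hAf hAg
  rw [rectIntegral_logDeriv_eq_zero hab hcd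
    (fun z hz => (hfB z hz).div (hgB z hz) (hg0 z hz)) hs] at h1
  have h2 := (mul_eq_zero.1 h1.symm).resolve_left two_pi_I_ne_zero
  exact sub_eq_zero.1 (by exact_mod_cast h2)

theorem left_mem_rectBoundary (hab : a ≤ b) (hcd : c ≤ d) :
    (a + c * I : ℂ) ∈ rectBoundary a b c d :=
  mem_rectBoundary_bottom hcd ⟨le_rfl, hab⟩

/-- The edges bound the order sum of p(z, W z) / p(z, y₀) by 8 · m · `p.natDegree`; the denominator
is a nonzero polynomial of degree at most m, which accounts for the extra m. -/
theorem sum_untop₀_evalAlong_le (hab : a ≤ b) (hcd : c ≤ d) (p : ℂ[X][X]) (m : ℕ)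
    (hm : ∀ k, (p.coeff k).natDegree ≤ m) {W : ℂ → ℂ} {y₀ : ℝ} (hWm : Meromorphic W)
    (hW : IsRealOnBoundary W y₀ a b c d) (hp : IsGenericOn p W y₀ a b c d)
    (A : Finset ℂ) (hA : ∀ z ∈ A, z ∈ (Set.Ioo a b ×ℂ Set.Ioo c d : Set ℂ))
    (hAf : ∀ z ∈ (Set.Ioo a b ×ℂ Set.Ioo c d : Set ℂ),
      meromorphicOrderAt (evalAlong p W) z ≠ 0 → z ∈ A) :
    ∑ z ∈ A, (meromorphicOrderAt (evalAlong p W) z).untop₀ ≤ (8 * m * p.natDegree + m : ℕ) := by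
  classical
  have hcorner := left_mem_rectBoundary hab hcd
  set q : ℂ[X] := p.eval (C (y₀ : ℂ)) with hq
  have hqe : (fun w => q.eval w) = fun w => (specialize p w).eval (y₀ : ℂ) := by
    ext w
    rw [hq, eval_eval_C]
  have hq0 : q ≠ 0 := by
    intro h0
    apply hp.eval_ne' _ hcorner
    rw [← eval_eval_C, ← hq, h0, eval_zero]
  have hfm := meromorphic_evalAlong p hWm
  have hgm : Meromorphic fun w => q.eval w := fun z => (analyticAt_polynomial_eval q z).meromorphicAt
  have hfB : ∀ z ∈ rectBoundary a b c d, AnalyticAt ℂ (evalAlong p W) z ∧ evalAlong p W z ≠ 0 :=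
    fun z hz => ⟨analyticAt_evalAlong p (hW.analyticAt z hz), hp.eval_ne z hz⟩
  have hft := hfm.meromorphicOrderAt_ne_top (hfB _ hcorner).1 (hfB _ hcorner).2
  have hgt : ∀ z, meromorphicOrderAt (fun w => q.eval w) z ≠ ⊤ := fun z => by
    rw [meromorphicOrderAt_polynomial_eval hq0]
    exact WithTop.coe_ne_top
  have hgB : ∀ z ∈ rectBoundary a b c d, AnalyticAt ℂ (fun w => q.eval w) z ∧ q.eval z ≠ 0 :=
    fun z hz => ⟨analyticAt_polynomial_eval q z, by
      rw [hq, eval_eval_C]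
      exact hp.eval_ne' z hz⟩
  have hfin := hgm.finite_meromorphicOrderAt_ne_zero hgt
    (isCompact_Icc.reProdIm isCompact_Icc : IsCompact (Set.Icc a b ×ℂ Set.Icc c d : Set ℂ))
  set B : Finset ℂ := hfin.toFinset.filter (· ∈ (Set.Ioo a b ×ℂ Set.Ioo c d : Set ℂ)) with hB
  have hAB : ∀ z ∈ A ∪ B, z ∈ (Set.Ioo a b ×ℂ Set.Ioo c d : Set ℂ) := fun z hz =>
    (Finset.mem_union.1 hz).elim (hA z) fun h => (Finset.mem_filter.1 h).2
  have hap := rectIntegral_logDeriv_div hab hcd hfm hgm hft hgt hfB hgB (A ∪ B) hAB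
    (fun z hz h => Finset.mem_union_left _ (hAf z hz h))
    (fun z hz h => Finset.mem_union_right _ (Finset.mem_filter.2
      ⟨hfin.mem_toFinset.2 ⟨mem_Icc_of_mem_Ioo_reProdIm hz, h⟩, hz⟩))
  have hsum : ∑ z ∈ A, (meromorphicOrderAt (evalAlong p W) z).untop₀ =
      ∑ z ∈ A ∪ B, (meromorphicOrderAt (evalAlong p W) z).untop₀ := by
    refine Finset.sum_subset Finset.subset_union_left fun z hz hzA => ?_
    rw [not_not.1 (mt (hAf z (hAB z hz)) hzA)]
    rfl
  have hg := (sum_untop₀_meromorphicOrderAt_polynomial_le hq0 (A ∪ B)).trans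
    (Int.ofNat_le.2 (natDegree_eval_C_le p m hm y₀))
  have hbound := abs_im_rectIntegral_logDeriv_le hab hcd p m hm hW hp
  have hcq : comparisonQuotient p W y₀ = evalAlong p W / fun w => q.eval w := by
    rw [hqe]
    rfl
  rw [hcq, hap] at hbound
  set N : ℤ := ∑ z ∈ A ∪ B, (meromorphicOrderAt (evalAlong p W) z).untop₀ -
    ∑ z ∈ A ∪ B, (meromorphicOrderAt (fun w => q.eval w) z).untop₀ with hN
  have him : (2 * Real.pi * I * (N : ℂ) : ℂ).im = 2 * Real.pi * N := by
    have : (2 * Real.pi * I * (N : ℂ) : ℂ) = ((2 * Real.pi * N : ℝ) : ℂ) * I := by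
      push_cast
      ring
    rw [this, im_ofReal_mul, I_im, mul_one]
  rw [him] at hbound
  have h2 : (N : ℝ) ≤ (8 * m * p.natDegree : ℕ) :=
    le_of_mul_le_mul_left ((le_abs_self _).trans hbound) Real.two_pi_pos
  have h3 : N ≤ (8 * m * p.natDegree : ℕ) := by exact_mod_cast h2
  rw [hsum]
  push_cast at h3 ⊢
  linarith

theorem continuousAt_eval_specialize (p : ℂ[X][X]) {T : Type*} [TopologicalSpace T] {u v : T → ℂ}
    {x : T} (hu : ContinuousAt u x) (hv : ContinuousAt v x) :
    ContinuousAt (fun x => (specialize p (u x)).eval (v x)) x := by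
  have : (fun x => (specialize p (u x)).eval (v x)) =
      fun x => ∑ k ∈ Finset.range (p.natDegree + 1), (p.coeff k).eval (u x) * v x ^ k := by
    ext z
    rw [specialize, eval_map, eval₂_eq_sum_range]
    rfl
  rw [this]
  refine tendsto_finsetSum _ fun k _ => ContinuousAt.mul ?_ (hv.pow k)
  exact ContinuousAt.comp (p.coeff k).continuous.continuousAt hu

/-- At zero shift the quotient is 1, an interior point of the slit plane; compactness makes the
neighbourhood of the zero shift uniform in z. -/
theorem exists_forall_shiftPoly_div_mem_slitPlane (p : ℂ[X][X]) {W : ℂ → ℂ} {K : Set ℂ}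
    (hK : IsCompact K) (hW : ∀ z ∈ K, ContinuousAt W z) (h0 : ∀ z ∈ K, evalAlong p W z ≠ 0) :
    ∃ ε > 0, ∀ κ e : ℂ, ‖κ‖ < ε → ‖e‖ < ε → ∀ z ∈ K,
      evalAlong (shiftPoly p κ e) W z / evalAlong p W z ∈ slitPlane := by
  have h := hK.eventually_forall_of_forall_eventually (x₀ := ((0, 0) : ℂ × ℂ))
    (P := fun q z => evalAlong (shiftPoly p q.1 q.2) W z / evalAlong p W z ∈ slitPlane) ?_
  · obtain ⟨ε, hε, h⟩ := Metric.eventually_nhds_iff.1 h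
    refine ⟨ε, hε, fun κ e hκ he => @h (κ, e) ?_⟩
    rw [Prod.dist_eq]
    exact max_lt (by simpa using hκ) (by simpa using he)
  intro z hz
  have hWc : ContinuousAt (fun x : (ℂ × ℂ) × ℂ => W x.2) ((0, 0), z) :=
    ContinuousAt.comp (g := W) (f := Prod.snd) (hW z hz) continuousAt_snd
  have hc : ContinuousAt (fun x : (ℂ × ℂ) × ℂ =>
      evalAlong (shiftPoly p x.1.1 x.1.2) W x.2 / evalAlong p W x.2) ((0, 0), z) := by
    simp only [evalAlong, eval_specialize_shiftPoly]
    refine ContinuousAt.div ?_ ?_ (h0 z hz)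
    · exact continuousAt_eval_specialize p (by fun_prop) (hWc.sub (by fun_prop))
    · exact continuousAt_eval_specialize p (by fun_prop) hWc
  refine hc.eventually (isOpen_slitPlane.mem_nhds ?_)
  simp only [evalAlong, eval_specialize_shiftPoly, sub_zero]
  rw [div_self (show (specialize p z).eval (W z) ≠ 0 from h0 z hz)]
  exact one_mem_slitPlane

/-- Each point of F lies on the shrunken boundary for only finitely many η, and every small η keeps
T inside. -/
theorem exists_inner_rectangle {F T : Set ℂ} (hF : F.Finite) (hT : T.Finite)
    (hTR : ∀ z ∈ T, z ∈ (Set.Ioo a b ×ℂ Set.Ioo c d : Set ℂ)) (hab : a < b) (hcd : c < d) :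
    ∃ η : ℝ, 0 < η ∧ a + η ≤ b - η ∧ c + η ≤ d - η ∧
      (∀ z ∈ T, z ∈ (Set.Ioo (a + η) (b - η) ×ℂ Set.Ioo (c + η) (d - η) : Set ℂ)) ∧
      ∀ z ∈ F, z ∉ rectBoundary (a + η) (b - η) (c + η) (d - η) := by
  have hlt : ∀ x : ℝ, 0 < x → ∀ᶠ η in 𝓝[>] (0 : ℝ), η < x := fun x hx =>
    (eventually_lt_nhds hx).filter_mono nhdsWithin_le_nhds
  have h1 : ∀ᶠ η in 𝓝[>] (0 : ℝ), η < (b - a) / 2 := hlt _ (by linarith)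
  have h2 : ∀ᶠ η in 𝓝[>] (0 : ℝ), η < (d - c) / 2 := hlt _ (by linarith)
  have h3 : ∀ᶠ η in 𝓝[>] (0 : ℝ), ∀ z ∈ T,
      z ∈ (Set.Ioo (a + η) (b - η) ×ℂ Set.Ioo (c + η) (d - η) : Set ℂ) := by
    refine (eventually_all_finite hT).2 fun z hz => ?_
    obtain ⟨⟨r1, r2⟩, ⟨r3, r4⟩⟩ := mem_reProdIm.1 (hTR z hz)
    filter_upwards [hlt (z.re - a) (by linarith), hlt (b - z.re) (by linarith),
      hlt (z.im - c) (by linarith), hlt (d - z.im) (by linarith)] with η e1 e2 e3 e4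
    exact mem_reProdIm.2 ⟨⟨by linarith, by linarith⟩, ⟨by linarith, by linarith⟩⟩
  obtain ⟨ε, hε, h⟩ := mem_nhdsGT_iff_exists_Ioo_subset.1 ((h1.and h2).and h3)
  obtain ⟨η, hη, hηF⟩ := exists_Ioo_notMem_of_finite
    (((hF.image fun z => z.re - a).union (hF.image fun z => b - z.re)).union
      ((hF.image fun z => z.im - c).union (hF.image fun z => d - z.im))) hε
  obtain ⟨⟨g1, g2⟩, g3⟩ := h hη
  simp only [Set.mem_union, not_or] at hηF
  refine ⟨η, hη.1, by linarith, by linarith, g3, fun z hz hzB => ?_⟩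
  rcases (rectBoundary_cases hzB).1 with h | h | h | h
  · exact hηF.1.1 ⟨z, hz, by simp only; linarith⟩
  · exact hηF.1.2 ⟨z, hz, by simp only; linarith⟩
  · exact hηF.2.1 ⟨z, hz, by simp only; linarith⟩
  · exact hηF.2.2 ⟨z, hz, by simp only; linarith⟩

/-- The zeros of `p(z, W z)` in the interior of a rectangle, counted with multiplicity, when `W` is
real on the boundary and has poles of order at most `n` in a finite set `Λ`. -/
theorem sum_toNat_meromorphicOrderAt_evalAlong_le (hab : a < b) (hcd : c < d) (p : ℂ[X][X])
    (hp : p ≠ 0) (m : ℕ) (hm : ∀ k, (p.coeff k).natDegree ≤ m) {W : ℂ → ℂ} {y₀ : ℝ}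
    (hWm : Meromorphic W) (hW : IsRealOnBoundary W y₀ a b c d) (Λ : Finset ℂ)
    (hΛ : ∀ z ∈ Λ, z ∈ (Set.Ioo a b ×ℂ Set.Ioo c d : Set ℂ))
    (hWa : ∀ z ∈ (Set.Icc a b ×ℂ Set.Icc c d : Set ℂ), z ∉ Λ → AnalyticAt ℂ W z) (n : ℕ)
    (hWn : ∀ z ∈ Λ, ((-n : ℤ) : WithTop ℤ) ≤ meromorphicOrderAt W z)
    (htop : ∀ z, meromorphicOrderAt (evalAlong p W) z ≠ ⊤) (S : Finset ℂ)
    (hS : ∀ z ∈ S, z ∈ (Set.Ioo a b ×ℂ Set.Ioo c d : Set ℂ)) :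
    ∑ z ∈ S, (meromorphicOrderAt (evalAlong p W) z).untop₀.toNat ≤
      8 * m * p.natDegree + m + n * p.natDegree * Λ.card := by
  classical
  have hK : IsCompact (Set.Icc a b ×ℂ Set.Icc c d : Set ℂ) := isCompact_Icc.reProdIm isCompact_Icc
  have hfm := meromorphic_evalAlong p hWm
  have hFfin := hfm.finite_meromorphicOrderAt_ne_zero htop hK
  set F := {z | z ∈ (Set.Icc a b ×ℂ Set.Icc c d : Set ℂ) ∧
    meromorphicOrderAt (evalAlong p W) z ≠ 0} with hF
  -- The function may vanish on the outer boundary, so Rouché is applied on a smaller one that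
  -- avoids its zeros. The edge bound still needs the outer boundary, where `W` is real.
  obtain ⟨η, hη, hab', hcd', hT', hF'⟩ := exists_inner_rectangle (F := F) (T := ↑(S ∪ Λ)) hFfin
    (Finset.finite_toSet _) (fun z hz => (Finset.mem_union.1 (Finset.mem_coe.1 hz)).elim (hS z)
      (hΛ z)) hab hcd
  set R' : Set ℂ := Set.Ioo (a + η) (b - η) ×ℂ Set.Ioo (c + η) (d - η) with hR'
  set B' := rectBoundary (a + η) (b - η) (c + η) (d - η) with hB'
  have hR'R : R' ⊆ (Set.Ioo a b ×ℂ Set.Ioo c d : Set ℂ) := fun z hz =>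
    ⟨⟨by linarith [hz.1.1], by linarith [hz.1.2]⟩, ⟨by linarith [hz.2.1], by linarith [hz.2.2]⟩⟩
  have hB'R : B' ⊆ (Set.Icc a b ×ℂ Set.Icc c d : Set ℂ) := fun z hz => by
    obtain ⟨-, h1, h2⟩ := rectBoundary_cases hz
    exact ⟨⟨by linarith [h1.1], by linarith [h1.2]⟩, ⟨by linarith [h2.1], by linarith [h2.2]⟩⟩
  have hWB' : ∀ z ∈ B', AnalyticAt ℂ W z := fun z hz => hWa z (hB'R hz) fun hzΛ =>
    hz.2 (hT' z (Finset.mem_coe.2 (Finset.mem_union_right _ hzΛ)))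
  have hfB' : ∀ z ∈ B', evalAlong p W z ≠ 0 := fun z hz h0 => by
    have h1 : meromorphicOrderAt (evalAlong p W) z = 0 := by
      by_contra hcon
      exact hF' z ⟨hB'R hz, hcon⟩ hz
    have h2 := analyticAt_evalAlong p (hWB' z hz)
    rw [h2.meromorphicOrderAt_eq] at h1
    have h3 : analyticOrderAt (evalAlong p W) z = 0 := by
      cases h4 : analyticOrderAt (evalAlong p W) z with
      | top => rw [h4] at h1; exact absurd h1 (by simp)
      | coe k => rw [h4] at h1; simpa using h1
    exact (h2.analyticOrderAt_eq_zero.1 h3) h0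
  obtain ⟨ε, hε, hclose⟩ := exists_forall_shiftPoly_div_mem_slitPlane p isCompact_rectBoundary
    (fun z hz => (hWB' z hz).continuousAt) hfB'
  obtain ⟨κ, e, hκ, he, hgen⟩ := exists_isGenericOn_shiftPoly hab.le hcd.le p hp hW hε
  set s := shiftPoly p κ e with hs
  have hsdeg : s.natDegree = p.natDegree := (shiftPoly_props p κ e).1
  have hsm := natDegree_coeff_shiftPoly_le p m hm κ e
  have hgm := meromorphic_evalAlong s hWm
  have hcorner := left_mem_rectBoundary hab.le hcd.le
  have hgt := hgm.meromorphicOrderAt_ne_top (analyticAt_evalAlong s (hW.analyticAt _ hcorner))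
    (hgen.eval_ne _ hcorner)
  have hGfin := hgm.finite_meromorphicOrderAt_ne_zero hgt hK
  set A : Finset ℂ := (hFfin.toFinset ∪ hGfin.toFinset ∪ (S ∪ Λ)).filter
    (· ∈ (Set.Ioo a b ×ℂ Set.Ioo c d : Set ℂ)) with hA
  have hAR : ∀ z ∈ A, z ∈ (Set.Ioo a b ×ℂ Set.Ioo c d : Set ℂ) := fun z hz =>
    (Finset.mem_filter.1 hz).2
  have hAf : ∀ z ∈ (Set.Ioo a b ×ℂ Set.Ioo c d : Set ℂ),
      meromorphicOrderAt (evalAlong p W) z ≠ 0 → z ∈ A := fun z hz h =>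
    Finset.mem_filter.2 ⟨Finset.mem_union_left _ (Finset.mem_union_left _
      (hFfin.mem_toFinset.2 ⟨mem_Icc_of_mem_Ioo_reProdIm hz, h⟩)), hz⟩
  have hAg : ∀ z ∈ (Set.Ioo a b ×ℂ Set.Ioo c d : Set ℂ),
      meromorphicOrderAt (evalAlong s W) z ≠ 0 → z ∈ A := fun z hz h =>
    Finset.mem_filter.2 ⟨Finset.mem_union_left _ (Finset.mem_union_right _
      (hGfin.mem_toFinset.2 ⟨mem_Icc_of_mem_Ioo_reProdIm hz, h⟩)), hz⟩
  set A' := A.filter (· ∈ R') with hA'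
  have hSA' : S ∪ Λ ⊆ A' := fun z hz => by
    have h1 := hT' z (Finset.mem_coe.2 hz)
    exact Finset.mem_filter.2 ⟨Finset.mem_filter.2 ⟨Finset.mem_union_right _ hz, hR'R h1⟩, h1⟩
  have hhur := sum_untop₀_eq_of_div_mem_slitPlane hab' hcd' hgm hfm hgt htop
    (fun z hz => analyticAt_evalAlong s (hWB' z hz))
    (fun z hz => analyticAt_evalAlong p (hWB' z hz)) (hclose κ e hκ he) A'
    (fun z hz => (Finset.mem_filter.1 hz).2)
    (fun z hz h => Finset.mem_filter.2 ⟨hAg z (hR'R hz) h, hz⟩)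
    (fun z hz h => Finset.mem_filter.2 ⟨hAf z (hR'R hz) h, hz⟩)
  have hbig := sum_untop₀_evalAlong_le hab.le hcd.le s m hsm hWm hW hgen A hAR hAg
  rw [hsdeg] at hbig
  -- All possible poles lie in the inner rectangle, so between the two rectangles the perturbed
  -- function has nonnegative orders.
  have hmono : ∑ z ∈ A', (meromorphicOrderAt (evalAlong s W) z).untop₀ ≤
      ∑ z ∈ A, (meromorphicOrderAt (evalAlong s W) z).untop₀ := by
    refine Finset.sum_le_sum_of_subset_of_nonneg (Finset.filter_subset _ _) fun z hz hz' => ?_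
    refine WithTop.untop₀_nonneg.2 (analyticAt_evalAlong s (hWa z
      (mem_Icc_of_mem_Ioo_reProdIm (hAR z hz)) fun hzΛ => ?_)).meromorphicOrderAt_nonneg
    exact hz' (hSA' (Finset.mem_union_right _ hzΛ))
  -- Off `Λ` the order is nonnegative; at a point of `Λ` it is at least -n · `p.natDegree`, so
  -- adding that amount dominates the zero count in either case.
  have hpt : ∀ z ∈ A', ((meromorphicOrderAt (evalAlong p W) z).untop₀.toNat : ℤ) ≤
      (meromorphicOrderAt (evalAlong p W) z).untop₀ +
        if z ∈ Λ then ((n * p.natDegree : ℕ) : ℤ) else 0 := by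
    intro z hz
    split_ifs with hzΛ
    · have h1 := le_meromorphicOrderAt_evalAlong p (hWm z) (hWn z hzΛ)
      have h2 := htop z
      lift meromorphicOrderAt (evalAlong p W) z to ℤ using h2 with k
      have h3 : (-(n * p.natDegree : ℕ) : ℤ) ≤ k := WithTop.coe_le_coe.1 h1
      rw [WithTop.untop₀_coe]
      omega
    · have h1 : 0 ≤ (meromorphicOrderAt (evalAlong p W) z).untop₀ :=
        WithTop.untop₀_nonneg.2 (analyticAt_evalAlong p (hWa z
          (mem_Icc_of_mem_Ioo_reProdIm (hAR z (Finset.mem_filter.1 hz).1))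
          hzΛ)).meromorphicOrderAt_nonneg
      omega
  have hfinal : ((∑ z ∈ S, (meromorphicOrderAt (evalAlong p W) z).untop₀.toNat : ℕ) : ℤ) ≤
      ((8 * m * p.natDegree + m : ℕ) : ℤ) + (n * p.natDegree * Λ.card : ℕ) := by
    calc ((∑ z ∈ S, (meromorphicOrderAt (evalAlong p W) z).untop₀.toNat : ℕ) : ℤ)
      _ ≤ ((∑ z ∈ A', (meromorphicOrderAt (evalAlong p W) z).untop₀.toNat : ℕ) : ℤ) :=
        Int.ofNat_le.2 (Finset.sum_le_sum_of_subset
          (Finset.subset_union_left.trans hSA'))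
      _ = ∑ z ∈ A', ((meromorphicOrderAt (evalAlong p W) z).untop₀.toNat : ℤ) := by push_cast; rfl
      _ ≤ _ := Finset.sum_le_sum hpt
      _ = ∑ z ∈ A', (meromorphicOrderAt (evalAlong p W) z).untop₀ +
          (n * p.natDegree * Λ.card : ℕ) := by
        rw [Finset.sum_add_distrib, ← Finset.sum_filter, Finset.filter_mem_eq_inter,
          Finset.inter_eq_right.2 (Finset.subset_union_right.trans hSA'), Finset.sum_const,
          nsmul_eq_mul]
        push_cast
        ring
      _ ≤ _ := by
        rw [← hhur]
        linarith
  exact_mod_cast hfinal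

end RectangleCount

/-! ### The ℘-function of a rectangular lattice -/

section WeierstrassRectangle

open Polynomial Filter Topology

variable {τ : ℝ} (hτ : 0 < τ)

theorem mem_lattice_rectPeriodPair_iff {z : ℂ} :
    z ∈ (rectPeriodPair τ hτ).lattice ↔ ∃ m n : ℤ, z.re = m ∧ z.im = n * τ := by
  rw [PeriodPair.mem_lattice]
  refine exists₂_congr fun m n => ?_
  constructor
  · rintro rfl
    simp [rectPeriodPair]
  · rintro ⟨h1, h2⟩
    apply Complex.ext <;> simp [rectPeriodPair, h1, h2]

/-- Conjugation permutes the rectangular lattice, hence also the terms of the series for ℘. -/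
theorem weierstrassP_conj (z : ℂ) :
    (rectPeriodPair τ hτ).weierstrassP (starRingEnd ℂ z) =
      starRingEnd ℂ ((rectPeriodPair τ hτ).weierstrassP z) := by
  set L := rectPeriodPair τ hτ with hL
  have hmem : ∀ x ∈ L.lattice, starRingEnd ℂ x ∈ L.lattice := by
    intro x hx
    rw [mem_lattice_rectPeriodPair_iff] at hx ⊢
    obtain ⟨m, n, h1, h2⟩ := hx
    exact ⟨m, -n, by simpa using h1, by simp [h2]⟩
  let e : L.lattice ≃ L.lattice :=
    { toFun := fun x => ⟨starRingEnd ℂ x.1, hmem x.1 x.2⟩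
      invFun := fun x => ⟨starRingEnd ℂ x.1, hmem x.1 x.2⟩
      left_inv := fun x => Subtype.ext (Complex.conj_conj _)
      right_inv := fun x => Subtype.ext (Complex.conj_conj _) }
  have h1 := Complex.hasSum_conj'.2 (L.hasSum_weierstrassP z)
  have h2 := e.hasSum_iff.2 (L.hasSum_weierstrassP (starRingEnd ℂ z))
  refine h2.unique ?_
  convert h1 using 2 with l
  simp [e]

theorem weierstrassP_add_of_mem {L : PeriodPair} {z l : ℂ} (hl : l ∈ L.lattice) :
    L.weierstrassP (z + l) = L.weierstrassP z :=
  L.weierstrassP_add_coe z ⟨l, hl⟩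

/-- If conj z ≡ ±z mod Λ, then periodicity and evenness of ℘ give ℘(conj z) = ℘(z). -/
theorem weierstrassP_im_eq_zero {z : ℂ} (h : starRingEnd ℂ z - z ∈ (rectPeriodPair τ hτ).lattice ∨
    starRingEnd ℂ z + z ∈ (rectPeriodPair τ hτ).lattice) :
    ((rectPeriodPair τ hτ).weierstrassP z).im = 0 := by
  rw [← Complex.conj_eq_iff_im, ← weierstrassP_conj]
  rcases h with h | h
  · rw [← weierstrassP_add_of_mem (z := z) h]
    congr 1
    ring
  · rw [← PeriodPair.weierstrassP_neg _ z, ← weierstrassP_add_of_mem (z := -z) h]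
    congr 1
    ring

theorem notMem_lattice_of_mem_rectBoundary {z : ℂ}
    (hz : z ∈ rectBoundary (-1 / 2) (3 / 2) (-τ / 2) (3 * τ / 2)) :
    z ∉ (rectPeriodPair τ hτ).lattice := by
  rw [mem_lattice_rectPeriodPair_iff]
  rintro ⟨m, n, h1, h2⟩
  rcases (rectBoundary_cases hz).1 with h | h | h | h
  · rw [h1] at h
    have : (2 * m : ℤ) = -1 := by exact_mod_cast (by push_cast; linarith : ((2 * m : ℤ) : ℝ) = -1)
    omega
  · rw [h1] at h
    have : (2 * m : ℤ) = 3 := by exact_mod_cast (by push_cast; linarith : ((2 * m : ℤ) : ℝ) = 3)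
    omega
  · rw [h2] at h
    have h' : (2 * n : ℝ) = -1 := mul_right_cancel₀ hτ.ne' (by linarith)
    have : (2 * n : ℤ) = -1 := by exact_mod_cast h'
    omega
  · rw [h2] at h
    have h' : (2 * n : ℝ) = 3 := mul_right_cancel₀ hτ.ne' (by linarith)
    have : (2 * n : ℤ) = 3 := by exact_mod_cast h'
    omega

/-- On the vertical sides conj z + z is -1 or 3; on the horizontal sides conj z - z is iτ or -3iτ;
all are periods. The corners differ by twice the basic periods, since the rectangle has sides 2 and
2τ. -/
theorem isRealOnBoundary_weierstrassP :
    IsRealOnBoundary (rectPeriodPair τ hτ).weierstrassP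
      ((rectPeriodPair τ hτ).weierstrassP (-1 / 2 - τ / 2 * I)).re
      (-1 / 2) (3 / 2) (-τ / 2) (3 * τ / 2) := by
  have him : ∀ z ∈ rectBoundary (-1 / 2) (3 / 2) (-τ / 2) (3 * τ / 2),
      ((rectPeriodPair τ hτ).weierstrassP z).im = 0 := by
    intro z hz
    apply weierstrassP_im_eq_zero
    rw [mem_lattice_rectPeriodPair_iff, mem_lattice_rectPeriodPair_iff]
    rcases (rectBoundary_cases hz).1 with h | h | h | h
    · exact Or.inr ⟨-1, 0, by rw [add_re, conj_re, h]; norm_num, by simp⟩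
    · exact Or.inr ⟨3, 0, by rw [add_re, conj_re, h]; norm_num, by simp⟩
    · exact Or.inl ⟨0, 1, by simp, by rw [sub_im, conj_im, h]; push_cast; ring⟩
    · exact Or.inl ⟨0, -3, by simp, by rw [sub_im, conj_im, h]; push_cast; ring⟩
  have hc : ((-1 / 2 - τ / 2 * I : ℂ)) ∈ rectBoundary (-1 / 2) (3 / 2) (-τ / 2) (3 * τ / 2) := by
    have := left_mem_rectBoundary (a := -1 / 2) (b := 3 / 2) (c := -τ / 2) (d := 3 * τ / 2)
      (by norm_num) (by linarith)
    convert this using 1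
    push_cast
    ring
  have hcorner : ∀ z : ℂ, z - (-1 / 2 - τ / 2 * I) ∈ (rectPeriodPair τ hτ).lattice →
      (rectPeriodPair τ hτ).weierstrassP z =
        (((rectPeriodPair τ hτ).weierstrassP (-1 / 2 - τ / 2 * I)).re : ℂ) := by
    intro z hz
    have h1 := weierstrassP_add_of_mem (z := (-1 / 2 - τ / 2 * I)) hz
    rw [add_sub_cancel] at h1
    rw [h1]
    exact Complex.ext rfl (by simp [him _ hc])
  refine ⟨fun z hz => PeriodPair.analyticOnNhd_weierstrassP _ z
    (notMem_lattice_of_mem_rectBoundary hτ hz), him, ?_, ?_, ?_, ?_⟩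
  · refine hcorner _ ((mem_lattice_rectPeriodPair_iff hτ).2 ⟨0, 0, ?_, ?_⟩)
    · norm_num
    · simp; ring
  · refine hcorner _ ((mem_lattice_rectPeriodPair_iff hτ).2 ⟨2, 0, ?_, ?_⟩)
    · norm_num
    · simp; ring
  · refine hcorner _ ((mem_lattice_rectPeriodPair_iff hτ).2 ⟨0, 2, ?_, ?_⟩)
    · norm_num
    · simp; ring
  · refine hcorner _ ((mem_lattice_rectPeriodPair_iff hτ).2 ⟨2, 2, ?_, ?_⟩)
    · norm_num
    · simp; ring

/-- Near the pole at 0 the values leave every bounded set, in particular every finite one. -/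
theorem PeriodPair.infinite_image_weierstrassP (L : PeriodPair) :
    (L.weierstrassP '' {z | z ∉ L.lattice}).Infinite := by
  intro hfin
  have h1 : Tendsto L.weierstrassP (𝓝[≠] 0) (Bornology.cobounded ℂ) := by
    refine tendsto_cobounded_of_meromorphicOrderAt_neg ?_
    rw [L.order_weierstrassP 0 L.lattice.zero_mem]
    decide
  have h2 : ∀ᶠ z in 𝓝[≠] (0 : ℂ), L.weierstrassP z ∉ L.weierstrassP '' {z | z ∉ L.lattice} :=
    h1.eventually (Bornology.isBounded_def.1 hfin.isBounded)
  have h3 : ∀ᶠ z in 𝓝[≠] (0 : ℂ), z ∈ ((L.lattice : Set ℂ) \ {0})ᶜ :=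
    mem_nhdsWithin_of_mem_nhds (L.compl_lattice_sdiff_singleton_mem_nhds 0)
  obtain ⟨z, ⟨hz2, hz3⟩, hz⟩ := ((h2.and h3).and self_mem_nhdsWithin).exists
  exact hz2 ⟨z, fun h => hz3 ⟨h, hz⟩, rfl⟩

/-- This is the algebraic independence of z and ℘. If p(z, ℘(z)) vanished identically, then for
fixed w the polynomial p(X, ℘(w)) would vanish at all w + nω₁ and so be zero. Then p, as a
polynomial in Y, would have infinitely many constant roots ℘(w). -/
theorem PeriodPair.meromorphicOrderAt_evalAlong_ne_top (L : PeriodPair) {p : ℂ[X][X]} (hp : p ≠ 0)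
    (z : ℂ) : meromorphicOrderAt (evalAlong p L.weierstrassP) z ≠ ⊤ := by
  intro htop
  have hm := meromorphic_evalAlong p L.meromorphic_weierstrassP
  have hall : ∀ w, meromorphicOrderAt (evalAlong p L.weierstrassP) w = ⊤ := fun w => by
    by_contra hw
    exact MeromorphicOn.meromorphicOrderAt_ne_top_of_isPreconnected (U := Set.univ)
      (fun x _ => hm x) isPreconnected_univ (Set.mem_univ w) (Set.mem_univ z) hw htop
  have hzero : ∀ w ∉ L.lattice, evalAlong p L.weierstrassP w = 0 := fun w hw => by
    have ha := analyticAt_evalAlong p (L.analyticOnNhd_weierstrassP w hw)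
    by_contra h0
    have h1 := hall w
    rw [ha.meromorphicOrderAt_eq_zero h0] at h1
    exact WithTop.zero_ne_top h1
  have hroot : ∀ w ∉ L.lattice, p.eval (C (L.weierstrassP w)) = 0 := fun w hw => by
    refine eq_zero_of_infinite_isRoot _ (Set.Infinite.mono ?_ (Set.infinite_range_of_injective
      (f := fun n : ℕ => w + n * L.ω₁) fun m n hmn => ?_))
    · rintro _ ⟨n, rfl⟩
      have hl : (n : ℂ) * L.ω₁ ∈ L.lattice := by
        rw [← nsmul_eq_mul]
        exact nsmul_mem L.ω₁_mem_lattice n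
      have h1 := hzero (w + n * L.ω₁) fun h => hw (by simpa using L.lattice.sub_mem h hl)
      rw [evalAlong, weierstrassP_add_of_mem hl] at h1
      change eval (w + n * L.ω₁) (p.eval (C (L.weierstrassP w))) = 0
      rw [eval_eval_C, h1]
    · have h1 : (m : ℂ) * L.ω₁ = n * L.ω₁ := add_left_cancel hmn
      have h2 : L.ω₁ ≠ 0 := by
        have := L.indep.ne_zero 0
        simpa using this
      exact_mod_cast mul_right_cancel₀ h2 h1
  refine hp (eq_zero_of_infinite_isRoot p (Set.Infinite.mono ?_
    (L.infinite_image_weierstrassP.image (f := (C : ℂ → ℂ[X])) C_injective.injOn)))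
  rintro _ ⟨_, ⟨w, hw, rfl⟩, rfl⟩
  exact hroot w hw

/-- The enlarged rectangle contains exactly the lattice points 0, 1, iτ, 1 + iτ. Each is a double
pole of ℘, whence the coefficient 8 = 2 · 4 of the last term. -/
theorem sum_toNat_meromorphicOrderAt_weierstrassP_le (p : ℂ[X][X]) (hp : p ≠ 0) (m : ℕ)
    (hm : ∀ k, (p.coeff k).natDegree ≤ m) (S : Finset ℂ)
    (hS : ∀ z ∈ S, z ∈ fundamentalRectangle τ 0) :
    ∑ z ∈ S, (meromorphicOrderAt (evalAlong p (rectPeriodPair τ hτ).weierstrassP) z).untop₀.toNat ≤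
      8 * m * p.natDegree + m + 8 * p.natDegree := by
  classical
  set Λ : Finset ℂ := {0, 1, I * τ, 1 + I * τ} with hΛ
  have hcard : Λ.card ≤ 4 := Finset.card_le_four
  have hmemΛ : ∀ z ∈ (rectPeriodPair τ hτ).lattice,
      z ∈ (Set.Icc (-1 / 2) (3 / 2) ×ℂ Set.Icc (-τ / 2) (3 * τ / 2) : Set ℂ) → z ∈ Λ := by
    intro z hz hzR
    obtain ⟨m, n, h1, h2⟩ := (mem_lattice_rectPeriodPair_iff hτ).1 hz
    obtain ⟨⟨r1, r2⟩, ⟨r3, r4⟩⟩ := mem_reProdIm.1 hzR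
    rw [h1] at r1 r2
    rw [h2] at r3 r4
    have a1 : -1 < m := by exact_mod_cast (by linarith : (-1 : ℝ) < m)
    have a2 : m < 2 := by exact_mod_cast (by linarith : (m : ℝ) < 2)
    have a3 : -1 < n := by
      exact_mod_cast (lt_of_mul_lt_mul_right (by linarith) hτ.le : (-1 : ℝ) < n)
    have a4 : n < 2 := by
      exact_mod_cast (lt_of_mul_lt_mul_right (by linarith) hτ.le : (n : ℝ) < 2)
    have b1 : m = 0 ∨ m = 1 := by omega
    have b2 : n = 0 ∨ n = 1 := by omega
    simp only [hΛ, Finset.mem_insert, Finset.mem_singleton]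
    rcases b1 with rfl | rfl <;> rcases b2 with rfl | rfl
    · left; apply Complex.ext <;> simp [h1, h2]
    · right; right; left; apply Complex.ext <;> simp [h1, h2]
    · right; left; apply Complex.ext <;> simp [h1, h2]
    · right; right; right; apply Complex.ext <;> simp [h1, h2]
  have hΛmem : ∀ z ∈ Λ, z ∈ (rectPeriodPair τ hτ).lattice ∧
      z ∈ (Set.Ioo (-1 / 2) (3 / 2) ×ℂ Set.Ioo (-τ / 2) (3 * τ / 2) : Set ℂ) := by
    intro z hz
    rw [mem_lattice_rectPeriodPair_iff, mem_reProdIm]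
    simp only [hΛ, Finset.mem_insert, Finset.mem_singleton] at hz
    rcases hz with rfl | rfl | rfl | rfl
    · exact ⟨⟨0, 0, by simp, by simp⟩, by norm_num, by simp [hτ]; linarith⟩
    · exact ⟨⟨1, 0, by simp, by simp⟩, by norm_num, by simp [hτ]; linarith⟩
    · exact ⟨⟨0, 1, by simp, by simp⟩, by norm_num, by simp; constructor <;> linarith⟩
    · exact ⟨⟨1, 1, by simp, by simp⟩, by norm_num, by simp; constructor <;> linarith⟩
  have h := sum_toNat_meromorphicOrderAt_evalAlong_le (a := -1 / 2) (b := 3 / 2) (c := -τ / 2)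
    (d := 3 * τ / 2) (by norm_num) (by linarith) p hp m hm
    (rectPeriodPair τ hτ).meromorphic_weierstrassP (isRealOnBoundary_weierstrassP hτ) Λ
    (fun z hz => (hΛmem z hz).2)
    (fun z hz hzΛ => (rectPeriodPair τ hτ).analyticOnNhd_weierstrassP z
      fun hzL => hzΛ (hmemΛ z hzL hz)) 2
    (fun z hz => by
      rw [(rectPeriodPair τ hτ).order_weierstrassP z (hΛmem z hz).1]
      exact le_rfl)
    ((rectPeriodPair τ hτ).meromorphicOrderAt_evalAlong_ne_top hp) S (fun z hz => ?_)
  · refine h.trans ?_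
    have : 2 * p.natDegree * Λ.card ≤ 2 * p.natDegree * 4 := Nat.mul_le_mul_left _ hcard
    linarith
  · obtain ⟨s, hs, t, ht, rfl⟩ := hS z hz
    rw [mem_reProdIm]
    have h1 : 0 ≤ t * τ := mul_nonneg ht.1 hτ.le
    have h2 : t * τ ≤ 1 * τ := mul_le_mul_of_nonneg_right ht.2 hτ.le
    have e1 : ((0 : ℂ) + s + t * (I * τ)).re = s := by simp
    have e2 : ((0 : ℂ) + s + t * (I * τ)).im = t * τ := by simp
    rw [e1, e2]
    exact ⟨⟨by linarith [hs.1], by linarith [hs.2]⟩, ⟨by linarith, by linarith⟩⟩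

end WeierstrassRectangle

/-! ### Passing from `MvPolynomial (Fin 2) ℂ` to `ℂ[X][X]` -/

section Bivariate

open Polynomial

/-- A polynomial in two variables as a polynomial in the second variable over the polynomials in
the first one. -/
noncomputable def toBivariate (P : MvPolynomial (Fin 2) ℂ) : ℂ[X][X] :=
  MvPolynomial.aeval ![C X, X] P

theorem eval_specialize_toBivariate (P : MvPolynomial (Fin 2) ℂ) (z w : ℂ) :
    (specialize (toBivariate P) z).eval w = MvPolynomial.eval ![z, w] P := by
  have h : ((evalRingHom w).comp (mapRingHom (evalRingHom z))).comp
      (MvPolynomial.aeval (R := ℂ) ![(C X : ℂ[X][X]), X]).toRingHom = MvPolynomial.eval ![z, w] := by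
    apply MvPolynomial.ringHom_ext
    · intro r
      simp [Polynomial.algebraMap_apply]
    · intro i
      fin_cases i <;> simp
  exact congrArg (fun φ => φ P) h

theorem toBivariate_ne_zero {P : MvPolynomial (Fin 2) ℂ} (hP : P ≠ 0) : toBivariate P ≠ 0 := by
  intro h0
  refine hP (MvPolynomial.funext fun x => ?_)
  have h1 := eval_specialize_toBivariate P (x 0) (x 1)
  have h2 : ![x 0, x 1] = x := by
    ext i
    fin_cases i <;> rfl
  rw [h2, h0] at h1
  rw [← h1]
  simp [specialize]

theorem toBivariate_eq_sum (P : MvPolynomial (Fin 2) ℂ) :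
    toBivariate P = ∑ s ∈ P.support, C (C (P.coeff s) * X ^ s 0) * X ^ s 1 := by
  rw [toBivariate, MvPolynomial.aeval_def, MvPolynomial.eval₂_eq']
  refine Finset.sum_congr rfl fun s _ => ?_
  rw [Fin.prod_univ_two, Polynomial.algebraMap_apply]
  simp [mul_assoc]

theorem natDegree_toBivariate_le (P : MvPolynomial (Fin 2) ℂ) :
    (toBivariate P).natDegree ≤ P.degreeOf 1 := by
  rw [toBivariate_eq_sum]
  exact natDegree_sum_le_of_forall_le _ _ fun s hs =>
    (natDegree_C_mul_X_pow_le _ _).trans (MvPolynomial.monomial_le_degreeOf 1 hs)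

theorem natDegree_coeff_toBivariate_le (P : MvPolynomial (Fin 2) ℂ) (k : ℕ) :
    ((toBivariate P).coeff k).natDegree ≤ P.degreeOf 0 := by
  rw [toBivariate_eq_sum, finsetSum_coeff]
  refine natDegree_sum_le_of_forall_le _ _ fun s hs => ?_
  rw [coeff_C_mul_X_pow]
  split_ifs
  · exact (natDegree_C_mul_X_pow_le _ _).trans (MvPolynomial.monomial_le_degreeOf 0 hs)
  · simp

theorem shiftPoly_ne_zero {p : ℂ[X][X]} (hp : p ≠ 0) (κ : ℂ) : shiftPoly p κ 0 ≠ 0 := by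
  obtain ⟨z, hz⟩ : ∃ z, p.leadingCoeff.eval z ≠ 0 := by
    by_contra! hcon
    exact leadingCoeff_ne_zero.2 hp (Polynomial.funext fun z => (hcon z).trans eval_zero.symm)
  intro h0
  have h1 := (shiftPoly_props p κ 0).2 (z + κ)
  rw [h0, add_sub_cancel_right, leadingCoeff_zero, eval_zero] at h1
  exact hz h1.symm

end Bivariate

theorem theorem2 (τ : ℝ) (hτ : 0 < τ) (d : ℕ) (P : MvPolynomial (Fin 2) ℂ) (hP : P ≠ 0)
    (hX : P.degreeOf 0 ≤ d) (hY : P.degreeOf 1 ≤ d)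
    (ω : ℂ) (hω : ω ∈ (rectPeriodPair τ hτ).lattice)
    (S : Finset ℂ) (hS : (S : Set ℂ) ⊆ fundamentalRectangle τ ω) :
    ∑ z ∈ S, zeroMultiplicity
        (fun w => MvPolynomial.eval ![w, (rectPeriodPair τ hτ).weierstrassP w] P) z
      ≤ ((8 * d ^ 2 + 14 * d + 5 : ℕ) : ℕ∞) := by
  classical
  set W := (rectPeriodPair τ hτ).weierstrassP with hW
  set f : ℂ → ℂ := fun w => MvPolynomial.eval ![w, W w] P with hf
  -- Since ω is a period of ℘, z ↦ f(z + ω) is again a polynomial in z and ℘(z): only the first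
  -- variable is shifted, and the degree bounds survive.
  set q := shiftPoly (toBivariate P) (-ω) 0 with hq
  have hq0 : q ≠ 0 := shiftPoly_ne_zero (toBivariate_ne_zero hP) _
  have hfq : f ∘ (· + ω) = evalAlong q W := by
    ext z
    rw [hq, evalAlong, eval_specialize_shiftPoly, eval_specialize_toBivariate, sub_neg_eq_add,
      sub_zero, Function.comp_apply, hf]
    simp only [hW, weierstrassP_add_of_mem hω]
  have hord : ∀ z, meromorphicOrderAt f z = meromorphicOrderAt (evalAlong q W) (z - ω) := fun z => by
    rw [← hfq, meromorphicOrderAt_comp_add_const_eq_meromorphicOrderAt, sub_add_cancel]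
  have hmult : ∀ z, zeroMultiplicity f z =
      ((meromorphicOrderAt (evalAlong q W) (z - ω)).untop₀.toNat : ℕ∞) := fun z => by
    rw [zeroMultiplicity, hord]
    have h1 := (rectPeriodPair τ hτ).meromorphicOrderAt_evalAlong_ne_top hq0 (z - ω)
    rw [← hW] at h1
    lift meromorphicOrderAt (evalAlong q W) (z - ω) to ℤ using h1 with k
    rfl
  have hcount := sum_toNat_meromorphicOrderAt_weierstrassP_le hτ q hq0 d
    (natDegree_coeff_shiftPoly_le _ d
      (fun k => (natDegree_coeff_toBivariate_le P k).trans hX) _ _)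
    (S.image (· - ω)) (fun z hz => by
      obtain ⟨w, hw, rfl⟩ := Finset.mem_image.1 hz
      obtain ⟨s, hs, t, ht, rfl⟩ := hS hw
      exact ⟨s, hs, t, ht, by ring⟩)
  rw [Finset.sum_image fun x _ y _ hxy => sub_left_injective hxy] at hcount
  have hdeg : q.natDegree ≤ d := by
    rw [hq, (shiftPoly_props _ _ _).1]
    exact (natDegree_toBivariate_le P).trans hY
  calc ∑ z ∈ S, zeroMultiplicity f z
    _ = ((∑ z ∈ S, (meromorphicOrderAt (evalAlong q W) (z - ω)).untop₀.toNat : ℕ) : ℕ∞) := by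
      rw [Nat.cast_sum]
      exact Finset.sum_congr rfl fun z _ => hmult z
    _ ≤ _ := Nat.cast_le.2 (hcount.trans ?_)
  -- The count is in fact at most 8d² + 9d, which is below the stated bound.
  have h1 : 8 * d * q.natDegree ≤ 8 * d * d := Nat.mul_le_mul_left _ hdeg
  nlinarith
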